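/- Let $A$ be a finite alphabet, $D$ a nonempty prediction space and $l:A\times D\to[0,l_{max}]$ a loss function. Assume that $D$ is either finite, or a bounded metric space with $l$ Lipschitz in its second argument: $|l(a,d)-l(a,d')|\le c\,\mathrm{dist}(d,d')$ for some constant $c$ and all $a,d,d'$. A scandictor for a finite set $B\subset\mathbb{Z}^2$ is a pair $(\Psi,F)$ of sequences of maps $\Psi_t:A^{t-1}\to B$ and $F_t:A^{t-1}\to D$, $1\le t\le|B|$, such that for every $x\in A^B$ the sites $\Psi_1,\Psi_2(x_{\Psi_1}),\dots,\Psi_{|B|}(x_{\Psi_1},\dots,x_{\Psi_{|B|-1}})$ exhaust $B$. Its cumulative loss is $L_{(\Psi,F)}(x)=\sum_{t=1}^{|B|}l\big(x_{\Psi_t},F_t(x_{\Psi_1},\dots,x_{\Psi_{t-1}})\big)$. A randomized scandictor for $B$ is a random choice of a scandictor for $B$. Let $V_n=\{0,\dots,n-1\}^2$. For a probability measure $Q$ on $A^{\mathbb{Z}^2}$ with marginals $Q_B$, let $U(l,Q_B)=\inf_{(\Psi,F)}E_{Q_B}\frac1{|B|}L_{(\Psi,F)}(X_B)$, the infimum being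 over all scandictors for $B$, and let $U(l,Q)=\lim_{n\to\infty}U(l,Q_{V_n})$, a limit that exists whenever $Q$ is stationary (shift invariant). (1) There is a sequence of randomized scandictors $(\Psi,F)_n$ for $V_n$, independent of $Q$, such that for every stationary $Q$ $$\lim_{n\to\infty}E_{Q_{V_n}}E\,\frac{1}{|V_n|}L_{(\Psi,F)_n}(X_{V_n})=U(l,Q),$$ where the inner expectation is over the randomization. (2) It can be taken to be exponential weighting over scandictors on small blocks. Precisely: there are finite sets $G_k\subset D$, $k\ge0$, with $G_k=D$ for all $k$ if $D$ is finite, such that for every $k\ge1$ and $d\in D$ some $d'\in G_k$ satisfies $|l(a,d)-l(a,d')|\le k^{-4}$ for all $a\in A$, and such that, for every sequence of natural numbers $m(n)\to\infty$ with $m(n)=o(\sqrt{\log n})$, (1) holds for a sequence of the following form. With $m=m(n)$, divide $V_n$ into $\lfloor n/m\rfloor^2$ blocks of size $m\times m$ (and remaining sites), and take the blocks in a continuous raster order. Let $\lambda$ be the number of all scandictors for $V_m$ with predictions in $G_m$, and $\eta=\sqrt{8\log\lambda}/\big(l_{max}\,m\,(n+m)\big)$ (with $\eta=0$ if the denominator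 is $0$). For each block, one of these $\lambda$ scandictors is drawn at random, independently of the earlier draws, the $j$-th one with probability $e^{-\eta L_j}/\sum_{j'}e^{-\eta L_{j'}}$, where $L_j$ is the total loss of the $j$-th scandictor, restarted on each of the preceding blocks; the drawn scandictor is used on the block. The remaining sites are scanned last, in any way. -/

import Mathlib

open Filter Topology MeasureTheory Asymptotics

noncomputable section

namespace Scandiction

/-- The square `V_n = {0, …, n-1} × {0, …, n-1}` of sites. -/
def square (n : ℕ) : Finset (ℤ × ℤ) :=
  Finset.Ico (0 : ℤ) n ×ˢ Finset.Ico (0 : ℤ) n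

/-- The first `t` values `x_{Ψ_1}, …, x_{Ψ_t}` observed when the array `x` on `B` is scanned with
the maps `Ψ`. Times are counted from `0`, so `Ψ t` has `t` previous observations as its input. -/
def observed {A : Type*} {B : Finset (ℤ × ℤ)} (Ψ : (t : Fin B.card) → (Fin t → A) → B)
    (x : B → A) : (t : ℕ) → t ≤ B.card → (Fin t → A)
  | 0, _ => Fin.elim0
  | t + 1, h =>
      Fin.snoc (α := fun _ => A) (observed Ψ x t (Nat.le_of_succ_le h))
        (x (Ψ ⟨t, h⟩ (observed Ψ x t (Nat.le_of_succ_le h))))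

/-- A (deterministic) scandictor for the finite set of sites `B`: scanning maps `Ψ_t : A^{t-1} → B`
that visit all of `B`, whatever the data, and predictors `F_t : A^{t-1} → D`. The alphabet `A` will
be finite with the discrete σ-algebra, so that every such map is measurable. -/
structure Scandictor (A D : Type*) (B : Finset (ℤ × ℤ)) where
  /-- the scanning maps -/
  Ψ : (t : Fin B.card) → (Fin t → A) → B
  /-- the predictors -/
  F : (t : Fin B.card) → (Fin t → A) → D
  /-- every site is visited -/
  visits_all : ∀ (x : B → A) (b : B), ∃ t : Fin B.card, Ψ t (observed Ψ x t t.2.le) = b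

instance {A D : Type*} [Finite A] [Finite D] (B : Finset (ℤ × ℤ)) :
    Finite (Scandictor A D B) :=
  Finite.of_injective
    (fun S : Scandictor A D B => (S.Ψ, S.F))
    (by
      rintro ⟨Ψ, F, h⟩ ⟨Ψ', F', h'⟩ heq
      simp only [Prod.mk.injEq] at heq
      obtain ⟨rfl, rfl⟩ := heq
      rfl)

instance {A D : Type*} [Finite A] [Finite D] (B : Finset (ℤ × ℤ)) :
    Fintype (Scandictor A D B) :=
  Fintype.ofFinite _

namespace Scandictor

variable {A D : Type*} {B : Finset (ℤ × ℤ)}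

/-- The site `Ψ_t(x_{Ψ_1}, …, x_{Ψ_{t-1}})` visited at time `t` on the array `x`. -/
def visit (S : Scandictor A D B) (x : B → A) (t : Fin B.card) : B :=
  S.Ψ t (observed S.Ψ x t t.2.le)

/-- The prediction `F_t(x_{Ψ_1}, …, x_{Ψ_{t-1}})` given at time `t` on the array `x`. -/
def predict (S : Scandictor A D B) (x : B → A) (t : Fin B.card) : D :=
  S.F t (observed S.Ψ x t t.2.le)

/-- The cumulative loss `L_{(Ψ,F)}(x_B)`. -/
def cumLoss (l : A → D → ℝ) (S : Scandictor A D B) (x : B → A) : ℝ :=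
  ∑ t : Fin B.card, l (x (S.visit x t)) (S.predict x t)

end Scandictor

/-- The marginal `Q_B` of the random field `Q` on the finite set of sites `B`. -/
def marginal {A : Type*} [MeasurableSpace A] (Q : Measure (ℤ × ℤ → A)) (B : Finset (ℤ × ℤ)) :
    Measure (B → A) :=
  Q.map (fun x (b : B) => x b)

/-- Shift invariance of a measure on the space of arrays. -/
def IsStationary {A : Type*} [MeasurableSpace A] (Q : Measure (ℤ × ℤ → A)) : Prop :=
  ∀ i : ℤ × ℤ, Q.map (fun x j => x (j + i)) = Q

/-- The scandictability `U(l, Q_B)` of `Q` on `B`. -/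
def scandictabilityOn {A D : Type*} [MeasurableSpace A] (l : A → D → ℝ)
    (Q : Measure (ℤ × ℤ → A)) (B : Finset (ℤ × ℤ)) : ℝ :=
  ⨅ S : Scandictor A D B, ∫ x, (1 / (B.card : ℝ)) * S.cumLoss l x ∂(marginal Q B)

/-- The scandictability `U(l, Q) = lim_n U(l, Q_{V_n})`. -/
def scandictability {A D : Type*} [MeasurableSpace A] (l : A → D → ℝ)
    (Q : Measure (ℤ × ℤ → A)) : ℝ :=
  limUnder atTop (fun n : ℕ => scandictabilityOn l Q (square n))

/-- A randomized scandictor for `B`: a scandictor for `B` that is drawn at random. -/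
abbrev RandomizedScandictor (A D : Type*) (B : Finset (ℤ × ℤ)) := PMF (Scandictor A D B)

/-- The expectation of the cumulative loss on the array `x`, with respect to the randomization. -/
def RandomizedScandictor.meanLoss {A D : Type*} {B : Finset (ℤ × ℤ)} (l : A → D → ℝ)
    (R : RandomizedScandictor A D B) (x : B → A) : ℝ :=
  ∑' S : Scandictor A D B, (R S).toReal * S.cumLoss l x

/-- The randomized scandictors `R n` for `V_n`, one and the same sequence for all stationary `Q`,
achieve the scandictability of every stationary `Q` (the limit that defines `U(l, Q)` exists, and
the expected normalized loss of `R n` tends to it). -/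
def AchievesScandictability {A D : Type*} [MeasurableSpace A] (l : A → D → ℝ)
    (R : (n : ℕ) → RandomizedScandictor A D (square n)) : Prop :=
  ∀ Q : Measure (ℤ × ℤ → A), IsProbabilityMeasure Q → IsStationary Q →
    Tendsto (fun n : ℕ => scandictabilityOn l Q (square n)) atTop (𝓝 (scandictability l Q)) ∧
    Tendsto
      (fun n : ℕ => ∫ x, (1 / ((square n).card : ℝ)) * (R n).meanLoss l x
        ∂(marginal Q (square n)))
      atTop (𝓝 (scandictability l Q))

/-! ### Block-wise exponential weighting -/

/-- The corner of the `i`-th of the `K * K` blocks of size `m × m`, `i = 0, 1, …`, in the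
continuous raster order: rows of blocks are scanned alternately from left to right and from right
to left. -/
def blockCorner (m K i : ℕ) : ℤ × ℤ :=
  ((m * (i / K) : ℕ), (m * (if Even (i / K) then i % K else K - 1 - i % K) : ℕ))

/-- The data in the `i`-th block of the array `x`, as an array on `V_m`. -/
def blockData {A : Type*} (m K : ℕ) (x : ℤ × ℤ → A) (i : ℕ) : square m → A :=
  fun v => x (blockCorner m K i + v)

/-- The data in the blocks that precede the `i`-th block. -/
def pastBlocks {A : Type*} (m K : ℕ) (x : ℤ × ℤ → A) (i : ℕ) : Fin i → square m → A :=
  fun k => blockData m K x k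

/-- The probability `exp (-η L_{j,i}) / ∑_{j'} exp (-η L_{j',i})` of choosing the scandictor `j` for
the next block, after the blocks `y 0, …, y (i - 1)` have been scanned; `L_{j,i}` is the total loss
of `j`, restarted on each of these blocks. -/
def expWeight {A D : Type*} [Finite A] [Finite D] {B : Finset (ℤ × ℤ)} (l : A → D → ℝ) (η : ℝ)
    {i : ℕ} (y : Fin i → B → A) (j : Scandictor A D B) : ℝ :=
  Real.exp (-η * ∑ k, j.cumLoss l (y k)) /
    ∑ j' : Scandictor A D B, Real.exp (-η * ∑ k, j'.cumLoss l (y k))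

/-- The parameter `η` that minimizes the regret bound
`log lam / η + m ^ 2 * lmax ^ 2 * η * (n + m) ^ 2 / 8`
for `lam` scandictors and blocks of size `m × m` in `V_n`. -/
def learningRate (lmax : ℝ) (lam n m : ℕ) : ℝ :=
  √(8 * Real.log lam) / (lmax * m * (n + m))

/-- A selection rule: for each of the `N` blocks and any data in the preceding blocks, the
scandictor (for `V_m`) that is used for the block. -/
abbrev Selection (A D : Type*) (m N : ℕ) :=
  (i : Fin N) → (Fin i → square m → A) → Scandictor A D (square m)

/-- The scandictor `S` for `V_n` scans the `⌊n/m⌋²` blocks of size `m × m` one after the other, the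
`i`-th one with the scandictor that the selection rule `J` gives (restarted at the block); the
sites that lie in no block come last, in any order and with any predictions. -/
def Follows {A D : Type*} {n m : ℕ} {G : Finset D} (S : Scandictor A D (square n))
    (J : Selection A G m (n / m * (n / m))) : Prop :=
  ∀ (x : ℤ × ℤ → A) (i : Fin (n / m * (n / m))) (r : Fin (square m).card)
    (t : Fin (square n).card), (t : ℕ) = i * (square m).card + r →
    (S.visit (fun v => x v) t : ℤ × ℤ) = blockCorner m (n / m) i +
      ((J i (pastBlocks m (n / m) x i)).visit (blockData m (n / m) x i) r : ℤ × ℤ) ∧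
    S.predict (fun v => x v) t =
      ((J i (pastBlocks m (n / m) x i)).predict (blockData m (n / m) x i) r : D)

/-- `R` is the exponential weighting algorithm on `V_n` over all scandictors for `m × m` blocks with
predictions in the finite set `G`: for each block a scandictor is drawn according to the
exponential weights, independently of the previous draws, and is used for that block. -/
def IsExpWeighting {A D : Type*} [Finite A] (l : A → D → ℝ) (lmax : ℝ) {n : ℕ} (m : ℕ)
    (G : Finset D) (R : RandomizedScandictor A D (square n)) : Prop :=
  ∃ (μ : PMF (Selection A G m (n / m * (n / m))))
    (S : Selection A G m (n / m * (n / m)) → Scandictor A D (square n)),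
    R = μ.map S ∧ (∀ J, Follows (S J) J) ∧
    ∀ (x : ℤ × ℤ → A) (j : Fin (n / m * (n / m)) → Scandictor A G (square m)),
      μ.toOuterMeasure {J | ∀ i : Fin (n / m * (n / m)), J i (pastBlocks m (n / m) x i) = j i} =
        ENNReal.ofReal (∏ i : Fin (n / m * (n / m)), expWeight (fun a (d : G) => l a d)
          (learningRate lmax (Fintype.card (Scandictor A G (square m))) n m)
          (pastBlocks m (n / m) x i) (j i))

end Scandiction

end

/-!
# Universal scandiction by exponential weighting over blocks

Write `U_n` for the scandictability of a stationary `Q` on the square `V_n`. A scandictor for `V_m`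
can be restarted on each of the `⌊n/m⌋ ^ 2` blocks of size `m × m` in `V_n`. By stationarity it has
the same expected loss on all of them, and only `O(m n)` sites remain; hence
`U_n ≤ U_m + O(m / n)` (`IsStationary.scandictabilityOn_square_le`), and `U_n` converges to
`inf_m U_m`.

Block-wise exponential weighting treats the scandictors for `V_m` as experts and the blocks as
rounds. On every array its mean loss exceeds that of the best expert by at most
`2 * lmax * m * (n + m) * √(log λ)` (`hedge_learningRate_regret`). The expectation of the minimum over
the experts is at most the minimum of the expectations, which is `U_m` per site up to the rounding
error `m ^ (-4)` of the predictions. Thus the normalized expected loss lies between `U_n` and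
`U_m + m ^ (-4) + O(m √(log λ) / n)` (`IsStationary.meanLoss_selectionPMF_le`). The number of experts
satisfies `log λ ≤ C * exp (m ^ 2) ^ q` (`log_card_scandictor_le`), which is `n ^ o(1)` for
`m = o(√(log n))`, so that all the error terms vanish. The rounded predictions can be chosen
polynomially many in `m` because the alphabet is finite and the loss bounded (`exists_rounding`):
only the vectors `(l a d)_a` matter, and they lie in a cube of dimension `|A|`.

A scandictor is a sequence of maps of the observed values, whereas block-wise scanning is naturally
described array by array. `exists_scandictor_of_causal` turns a non-anticipating description of the
second kind into a scandictor, and `exists_followsVia` applies it to block-wise scanning. The random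
choices form a product measure (`piPMF`) over all blocks and all data in the preceding blocks.
-/

namespace Scandiction

/-! ### Scandictors described by what they do on each array -/

section Basics

variable {A D E : Type*} {B : Finset (ℤ × ℤ)}

theorem card_square (n : ℕ) : (square n).card = n * n := by
  simp [square]

theorem observed_apply (Ψ : (t : Fin B.card) → (Fin t → A) → B) (x : B → A) (t : ℕ)
    (ht : t ≤ B.card) (s : Fin t) :
    observed Ψ x t ht s =
      x (Ψ ⟨s, s.2.trans_le ht⟩ (observed Ψ x s (s.2.le.trans ht))) := by
  induction t with
  | zero => exact s.elim0
  | succ t ih =>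
    induction s using Fin.lastCases with
    | last => simp [observed]
    | cast s => simpa [observed] using ih (Nat.le_of_succ_le ht) s

namespace Scandictor

/-- What a scandictor does at time `t` depends only on the values that it has seen before. -/
theorem visit_predict_congr (S : Scandictor A D B) {x x' : B → A} {t : Fin B.card}
    (h : ∀ s < t, x (S.visit x s) = x' (S.visit x' s)) :
    S.visit x t = S.visit x' t ∧ S.predict x t = S.predict x' t := by
  have : observed S.Ψ x t t.2.le = observed S.Ψ x' t t.2.le := by
    funext s
    rw [observed_apply, observed_apply]
    exact h ⟨s, s.2.trans t.2⟩ s.2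
  simp only [visit, predict, this, and_self]

/-- Since every site is visited, the sequence of observed values determines the array. -/
theorem eq_of_forall_visit (S : Scandictor A D B) {x x' : B → A}
    (h : ∀ t, x (S.visit x t) = x' (S.visit x' t)) : x = x' := by
  funext b
  obtain ⟨t, ht⟩ := S.visits_all x b
  have h1 : S.visit x t = b := ht
  have h2 : S.visit x' t = b := by
    rw [← (S.visit_predict_congr fun s _ => h s).1, h1]
  simpa [h1, h2] using h t

/-- The scandictor that scans like `S` and predicts `g d` where `S` predicts `d`. -/
def mapPredict (g : D → E) (S : Scandictor A D B) : Scandictor A E B :=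
  ⟨S.Ψ, fun t o => g (S.F t o), S.visits_all⟩

theorem cumLoss_nonneg {l : A → D → ℝ} (hl : ∀ a d, 0 ≤ l a d) (S : Scandictor A D B)
    (x : B → A) : 0 ≤ S.cumLoss l x :=
  Finset.sum_nonneg fun _ _ => hl _ _

theorem cumLoss_le {l : A → D → ℝ} {M : ℝ} (hl : ∀ a d, l a d ≤ M) (S : Scandictor A D B)
    (x : B → A) : S.cumLoss l x ≤ B.card * M := by
  refine (Finset.sum_le_card_nsmul _ _ M fun _ _ => hl _ _).trans ?_
  simp

end Scandictor

/-- A non-anticipating description of a scan and of predictions, array by array, comes from a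
scandictor. -/
theorem exists_scandictor_of_causal [Nonempty D] (v : (ℤ × ℤ → A) → Fin B.card → B)
    (p : (ℤ × ℤ → A) → Fin B.card → D) (hv : ∀ x b, ∃ t, v x t = b)
    (hc : ∀ x x' t, (∀ s < t, x (v x s) = x' (v x' s)) → v x t = v x' t ∧ p x t = p x' t) :
    ∃ S : Scandictor A D B, ∀ (x : ℤ × ℤ → A) (t : Fin B.card),
      S.visit (fun b => x b) t = v x t ∧ S.predict (fun b => x b) t = p x t := by
  classical
  have hB (t : Fin B.card) : Nonempty B := (Finset.card_pos.1 (Fin.pos t)).to_subtype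
  -- `P t o x` says that the first `t` observations on `x` are `o`.
  let P (t : Fin B.card) (o : Fin t → A) (x : ℤ × ℤ → A) : Prop :=
    ∀ s : Fin t, x (v x ⟨s, s.2.trans t.2⟩) = o s
  let Ψ (t : Fin B.card) (o : Fin t → A) : B :=
    if h : ∃ x, P t o x then v h.choose t else (hB t).some
  let F (t : Fin B.card) (o : Fin t → A) : D :=
    if h : ∃ x, P t o x then p h.choose t else Classical.arbitrary D
  have hΨF (t o x) (h : P t o x) : Ψ t o = v x t ∧ F t o = p x t := by
    have hex : ∃ x, P t o x := ⟨x, h⟩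
    simp only [Ψ, F, dif_pos hex]
    exact hc _ _ _ fun s hs => (hex.choose_spec ⟨s, hs⟩).trans (h ⟨s, hs⟩).symm
  have key (x : ℤ × ℤ → A) (t : ℕ) : ∀ ht : t < B.card,
      P ⟨t, ht⟩ (observed Ψ (fun b => x b) t ht.le) x := by
    induction t using Nat.strong_induction_on with
    | _ t ih =>
      intro ht s
      rw [observed_apply, (hΨF _ _ x (ih s s.2 (s.2.trans ht))).1]
  refine ⟨⟨Ψ, F, fun x b => ?_⟩, fun x t => hΨF _ _ x (key x t t.2)⟩
  let y (w : ℤ × ℤ) : A := if hw : w ∈ B then x ⟨w, hw⟩ else x b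
  have hy : (fun b : B => y b) = x := by funext b; simp [y]
  obtain ⟨t, ht⟩ := hv y b
  have h := (hΨF t _ y (key y t t.2)).1
  rw [hy, ht] at h
  exact ⟨t, h⟩

instance [Nonempty D] : Nonempty (Scandictor A D B) :=
  ⟨⟨fun t _ => B.equivFin.symm t, fun _ _ => Classical.arbitrary D,
    fun _ b => ⟨B.equivFin b, by simp⟩⟩⟩

/-- A scandictor for `B` consists of at most `|B| * |A| ^ |B|` scanning decisions and predictions. -/
theorem card_scandictor_le [Finite A] [Nonempty A] [Finite D] :
    Fintype.card (Scandictor A D B) ≤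
      (B.card * Nat.card D) ^ (B.card * Nat.card A ^ B.card) := by
  classical
  have := Fintype.ofFinite A
  have := Fintype.ofFinite D
  let f (S : Scandictor A D B) : (Σ t : Fin B.card, (Fin t → A)) → B × D :=
    fun q => (S.Ψ q.1 q.2, S.F q.1 q.2)
  have hf : Function.Injective f := by
    rintro ⟨Ψ, F, h⟩ ⟨Ψ', F', h'⟩ heq
    have h1 : Ψ = Ψ' := by
      funext t o; exact congrArg Prod.fst (congrFun heq ⟨t, o⟩)
    have h2 : F = F' := by
      funext t o; exact congrArg Prod.snd (congrFun heq ⟨t, o⟩)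
    subst h1 h2; rfl
  have h1 := Fintype.card_le_of_injective f hf
  have hexp : Fintype.card (Σ t : Fin B.card, (Fin t → A)) ≤ B.card * Nat.card A ^ B.card := by
    rw [Fintype.card_sigma]
    refine (Finset.sum_le_card_nsmul _ _ (Nat.card A ^ B.card) fun t _ => ?_).trans (by simp)
    simp only [Fintype.card_fun, Fintype.card_fin, Nat.card_eq_fintype_card]
    exact Nat.pow_le_pow_right Fintype.card_pos t.2.le
  rw [Fintype.card_fun, Fintype.card_prod, Fintype.card_coe, ← Nat.card_eq_fintype_card (α := D)]
    at h1
  rcases (B.card * Nat.card D).eq_zero_or_pos with h0 | h0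
  · rcases Nat.eq_zero_or_pos B.card with hb | hb
    · have : IsEmpty (Σ t : Fin B.card, (Fin t → A)) := ⟨fun q => by
        have := q.1.2; omega⟩
      simpa [hb] using h1
    · have hD : IsEmpty D := by
        by_contra hne
        rw [not_isEmpty_iff] at hne
        exact (Nat.mul_pos hb Nat.card_pos).ne' h0
      have : IsEmpty (Scandictor A D B) := ⟨fun S => hD.elim
        (S.F ⟨0, hb⟩ fun s => (Nat.not_lt_zero _ s.2).elim)⟩
      simp
  · exact h1.trans (Nat.pow_le_pow_right h0 hexp)

end Basics

/-! ### Scanning a square block by block -/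

section Blocks

variable {A D E : Type*}

theorem mem_square {n : ℕ} {w : ℤ × ℤ} :
    w ∈ square n ↔ (0 ≤ w.1 ∧ w.1 < n) ∧ (0 ≤ w.2 ∧ w.2 < n) := by
  simp [square]

theorem square_subset {m n : ℕ} (h : m ≤ n) : square m ⊆ square n := by
  intro w hw
  rw [mem_square] at *
  omega

theorem blockCorner_add_mem {m K i : ℕ} (hi : i < K * K) {v : ℤ × ℤ} (hv : v ∈ square m) :
    blockCorner m K i + v ∈ square (m * K) := by
  have hK : 0 < K := Nat.pos_of_mul_pos_left (Nat.zero_lt_of_lt hi)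
  have h1 : i / K < K := Nat.div_lt_of_lt_mul hi
  have h2 : (if Even (i / K) then i % K else K - 1 - i % K) < K := by
    have := Nat.mod_lt i hK
    split_ifs <;> omega
  have aux (c : ℕ) (hc : c < K) (z : ℤ) (hz0 : 0 ≤ z) (hz : z < m) :
      0 ≤ ((m * c : ℕ) : ℤ) + z ∧ ((m * c : ℕ) : ℤ) + z < ((m * K : ℕ) : ℤ) := by
    have : m * (c + 1) ≤ m * K := Nat.mul_le_mul_left _ hc
    rw [Nat.mul_add] at this
    omega
  rw [mem_square] at *
  exact ⟨aux _ h1 _ hv.1.1 hv.1.2, aux _ h2 _ hv.2.1 hv.2.2⟩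

theorem exists_blockCorner_add {m K : ℕ} {w : ℤ × ℤ} (hw : w ∈ square (m * K)) :
    ∃ i < K * K, ∃ v ∈ square m, blockCorner m K i + v = w := by
  rw [mem_square] at hw
  obtain ⟨⟨h1, h2⟩, h3, h4⟩ := hw
  obtain ⟨a, ha⟩ := Int.eq_ofNat_of_zero_le h1
  obtain ⟨b, hb⟩ := Int.eq_ofNat_of_zero_le h3
  have ha' : a < m * K := by omega
  have hb' : b < m * K := by omega
  have hm : 0 < m := Nat.pos_of_mul_pos_right (Nat.zero_lt_of_lt ha')
  have haK : a / m < K := Nat.div_lt_of_lt_mul ha'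
  have hbK : b / m < K := Nat.div_lt_of_lt_mul hb'
  obtain ⟨c, hc, hcb⟩ : ∃ c < K, (if Even (a / m) then c else K - 1 - c) = b / m := by
    generalize b / m = q at hbK
    by_cases h : Even (a / m)
    · exact ⟨q, hbK, if_pos h⟩
    · exact ⟨K - 1 - q, by omega, by rw [if_neg h]; omega⟩
  have hdiv : (c + K * (a / m)) / K = a / m := by
    rw [Nat.add_mul_div_left _ _ (by omega), Nat.div_eq_of_lt hc, zero_add]
  have hmod : (c + K * (a / m)) % K = c := by
    rw [Nat.add_mul_mod_self_left, Nat.mod_eq_of_lt hc]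
  refine ⟨c + K * (a / m), ?_, ((a % m : ℕ), (b % m : ℕ)), ?_, ?_⟩
  · calc c + K * (a / m) < K * (a / m + 1) := by rw [Nat.mul_add]; omega
      _ ≤ K * K := Nat.mul_le_mul_left _ haK
  · rw [mem_square]
    have := Nat.mod_lt a hm
    have := Nat.mod_lt b hm
    simp only
    omega
  · rw [blockCorner, hdiv, hmod, hcb]
    have := Nat.div_add_mod a m
    have := Nat.div_add_mod b m
    ext
    · simp only [Prod.mk_add_mk]; omega
    · simp only [Prod.mk_add_mk]; omega

/-- The scandictor `S` for `V_n` scans `K * K` blocks of size `m × m` as the selection rule `J`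
prescribes. This is `Follows` for any number of blocks, and for block scandictors that predict in a
space `E` mapped to `D` by `g` instead of in a finite subset of `D`. -/
def FollowsVia {n m K : ℕ} (g : E → D) (S : Scandictor A D (square n))
    (J : Selection A E m (K * K)) : Prop :=
  ∀ (x : ℤ × ℤ → A) (i : Fin (K * K)) (r : Fin (square m).card)
    (t : Fin (square n).card), (t : ℕ) = i * (square m).card + r →
    (S.visit (fun v => x v) t : ℤ × ℤ) = blockCorner m K i +
      ((J i (pastBlocks m K x i)).visit (blockData m K x i) r : ℤ × ℤ) ∧
    S.predict (fun v => x v) t =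
      g ((J i (pastBlocks m K x i)).predict (blockData m K x i) r)

/-- Every selection rule can be followed. A scandictor only sees the sequence of observed values,
but that sequence determines the contents of all completed blocks, and hence the scandictor that is
selected for the current one. -/
theorem exists_followsVia [Nonempty D] {n m K : ℕ} (hKn : m * K ≤ n) (g : E → D)
    (J : Selection A E m (K * K)) :
    ∃ S : Scandictor A D (square n), FollowsVia g S J := by
  classical
  set c := (square m).card with hc
  have hcK : K * K * c = (square (m * K)).card := by
    rw [hc, card_square, card_square]; ring
  -- The sites outside the blocks are visited last, in the order of an arbitrary enumeration.
  let rest : Finset (ℤ × ℤ) := square n \ square (m * K)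
  have hrest : rest.card = (square n).card - K * K * c := by
    rw [hcK, Finset.card_sdiff_of_subset (square_subset hKn)]
  have hle : K * K * c ≤ (square n).card := by
    rw [hcK]; exact Finset.card_le_card (square_subset hKn)
  have hi {t : ℕ} (h : t < K * K * c) : t / c < K * K :=
    Nat.div_lt_of_lt_mul (by rwa [Nat.mul_comm])
  have hr {t : ℕ} (h : t < K * K * c) : t % c < c :=
    Nat.mod_lt _ (Nat.pos_of_mul_pos_left (Nat.zero_lt_of_lt h))
  have hq {t : Fin (square n).card} (h : ¬ (t : ℕ) < K * K * c) :
      (t : ℕ) - K * K * c < rest.card := by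
    have := t.2
    omega
  let j (x : ℤ × ℤ → A) (i : Fin (K * K)) : Scandictor A E (square m) :=
    J i (pastBlocks m K x i)
  let v (x : ℤ × ℤ → A) (t : Fin (square n).card) : square n :=
    if h : (t : ℕ) < K * K * c then
      ⟨blockCorner m K (t / c) + ((j x ⟨t / c, hi h⟩).visit (blockData m K x (t / c))
        ⟨t % c, hr h⟩ : ℤ × ℤ),
        square_subset hKn (blockCorner_add_mem (hi h) (Subtype.prop _))⟩
    else ⟨rest.equivFin.symm ⟨t - K * K * c, hq h⟩,
      (Finset.mem_sdiff.1 (Subtype.prop (rest.equivFin.symm ⟨t - K * K * c, hq h⟩))).1⟩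
  let p (x : ℤ × ℤ → A) (t : Fin (square n).card) : D :=
    if h : (t : ℕ) < K * K * c then
      g ((j x ⟨t / c, hi h⟩).predict (blockData m K x (t / c)) ⟨t % c, hr h⟩)
    else Classical.arbitrary D
  have hvp (x : ℤ × ℤ → A) (i : Fin (K * K)) (r : Fin c) (t : Fin (square n).card)
      (ht : (t : ℕ) = i * c + r) :
      (v x t : ℤ × ℤ) = blockCorner m K i + ((j x i).visit (blockData m K x i) r : ℤ × ℤ) ∧
        p x t = g ((j x i).predict (blockData m K x i) r) := by
    have h : (t : ℕ) < K * K * c := by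
      calc (t : ℕ) < (i + 1) * c := by rw [ht, Nat.add_mul]; omega
        _ ≤ K * K * c := Nat.mul_le_mul_right _ i.2
    have hdiv : (t : ℕ) / c = i := by
      rw [ht, Nat.add_comm, Nat.add_mul_div_right _ _ (Fin.pos r), Nat.div_eq_of_lt r.2, zero_add]
    have hmod : (t : ℕ) % c = r := by
      rw [ht, Nat.add_comm, Nat.add_mul_mod_self_right, Nat.mod_eq_of_lt r.2]
    have hi' : (⟨t / c, hi h⟩ : Fin (K * K)) = i := Fin.ext hdiv
    have hr' : (⟨t % c, hr h⟩ : Fin c) = r := Fin.ext hmod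
    constructor
    · simp only [v, dif_pos h]
      rw [hi', hr', hdiv]
    · simp only [p, dif_pos h]
      rw [hi', hr', hdiv]
  have htime (i : Fin (K * K)) (r : Fin c) : i * c + r < (square n).card := by
    calc i * c + r < (i + 1) * c := by rw [Nat.add_mul]; omega
      _ ≤ K * K * c := Nat.mul_le_mul_right _ i.2
      _ ≤ _ := hle
  -- The value seen at time `i * c + r` is the one seen at time `r` of the scan of block `i`.
  have hval (x : ℤ × ℤ → A) (i : Fin (K * K)) (r : Fin c) :
      x (v x ⟨i * c + r, htime i r⟩) =
        blockData m K x i ((j x i).visit (blockData m K x i) r) := by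
    rw [(hvp x i r _ rfl).1]; rfl
  -- Observations up to the end of block `i` determine its contents.
  have hblock (x x' : ℤ × ℤ → A) (t : Fin (square n).card)
      (h : ∀ s < t, x (v x s) = x' (v x' s)) (i : ℕ) (hit : (i + 1) * c ≤ t)
      (hiK : i < K * K) : blockData m K x i = blockData m K x' i := by
    induction i using Nat.strong_induction_on with
    | _ i ih =>
      have hpast : pastBlocks m K x i = pastBlocks m K x' i := by
        funext k
        refine ih k k.2 (le_trans (Nat.mul_le_mul_right _ ?_) hit) (k.2.trans hiK)
        omega
      have hj : j x ⟨i, hiK⟩ = j x' ⟨i, hiK⟩ := congrArg (J ⟨i, hiK⟩) hpast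
      refine (j x ⟨i, hiK⟩).eq_of_forall_visit fun r => ?_
      have h1 := h ⟨i * c + r, htime ⟨i, hiK⟩ r⟩ (by
        rw [Fin.lt_def]
        have := r.2
        rw [Nat.add_mul] at hit
        simp only
        omega)
      have h2 := hval x ⟨i, hiK⟩ r
      have h3 := hval x' ⟨i, hiK⟩ r
      rw [← hj] at h3
      exact h2.symm.trans (h1.trans h3)
  have hcover (x : ℤ × ℤ → A) (b : square n) : ∃ t, v x t = b := by
    by_cases hb : (b : ℤ × ℤ) ∈ square (m * K)
    · obtain ⟨i, hiK, w, hw, hiw⟩ := exists_blockCorner_add hb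
      obtain ⟨r, hr⟩ := (j x ⟨i, hiK⟩).visits_all (blockData m K x i) ⟨w, hw⟩
      refine ⟨⟨i * c + r, htime ⟨i, hiK⟩ r⟩, Subtype.ext ?_⟩
      rw [(hvp x ⟨i, hiK⟩ r _ rfl).1, ← hiw]
      exact congrArg (fun z : square m => blockCorner m K i + (z : ℤ × ℤ)) hr
    · have hb' : (b : ℤ × ℤ) ∈ rest := Finset.mem_sdiff.2 ⟨b.2, hb⟩
      have hlt := (rest.equivFin ⟨b, hb'⟩).2
      refine ⟨⟨K * K * c + rest.equivFin ⟨b, hb'⟩, by omega⟩, Subtype.ext ?_⟩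
      simp [v]
  have hcausal (x x' : ℤ × ℤ → A) (t : Fin (square n).card)
      (h : ∀ s < t, x (v x s) = x' (v x' s)) : v x t = v x' t ∧ p x t = p x' t := by
    by_cases ht : (t : ℕ) < K * K * c
    · have htd : (t : ℕ) = t / c * c + t % c := by
        rw [Nat.mul_comm]; exact (Nat.div_add_mod _ _).symm
      have hpast : pastBlocks m K x (t / c) = pastBlocks m K x' (t / c) := by
        funext k
        refine hblock x x' t h k ?_ (k.2.trans (hi ht))
        calc (k + 1) * c ≤ t / c * c := Nat.mul_le_mul_right _ k.2
          _ ≤ t := Nat.div_mul_le_self _ _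
      have hj : j x ⟨t / c, hi ht⟩ = j x' ⟨t / c, hi ht⟩ := congrArg (J ⟨t / c, hi ht⟩) hpast
      have hcongr := (j x ⟨t / c, hi ht⟩).visit_predict_congr
        (x := blockData m K x (t / c)) (x' := blockData m K x' (t / c)) (t := ⟨t % c, hr ht⟩)
        (fun r hr => by
          have h1 := h ⟨t / c * c + r, htime ⟨t / c, hi ht⟩ r⟩ (by
            rw [Fin.lt_def] at hr ⊢
            simp only at hr ⊢
            omega)
          have h2 := hval x ⟨t / c, hi ht⟩ r
          have h3 := hval x' ⟨t / c, hi ht⟩ r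
          rw [← hj] at h3
          exact h2.symm.trans (h1.trans h3))
      have e1 := hvp x ⟨t / c, hi ht⟩ ⟨t % c, hr ht⟩ t htd
      have e2 := hvp x' ⟨t / c, hi ht⟩ ⟨t % c, hr ht⟩ t htd
      rw [← hj] at e2
      refine ⟨Subtype.ext ?_, ?_⟩
      · rw [e1.1, e2.1, hcongr.1]
      · rw [e1.2, e2.2, hcongr.2]
    · simp [v, p, ht]
  obtain ⟨S, hS⟩ := exists_scandictor_of_causal v p hcover hcausal
  refine ⟨S, fun x i r t ht => ?_⟩
  rw [(hS x t).1, (hS x t).2]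
  exact hvp x i r t ht

end Blocks

section BlockLoss

variable {A D E : Type*}

theorem sum_range_mul_eq (f : ℕ → ℝ) (N c : ℕ) :
    ∑ t ∈ Finset.range (N * c), f t =
      ∑ i ∈ Finset.range N, ∑ r ∈ Finset.range c, f (i * c + r) := by
  induction N with
  | zero => simp
  | succ N ih => rw [Nat.add_mul, one_mul, Finset.sum_range_add, ih, Finset.sum_range_succ]

/-- The loss of a block-wise scan is the loss on the blocks plus that on the remaining sites. -/
theorem FollowsVia.cumLoss_le {n m K : ℕ} (hKn : m * K ≤ n) {l : A → D → ℝ} {lmax : ℝ}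
    (hl : ∀ a d, l a d ≤ lmax) {g : E → D} {S : Scandictor A D (square n)}
    {J : Selection A E m (K * K)} (hS : FollowsVia g S J) (x : ℤ × ℤ → A) :
    S.cumLoss l (fun v => x v) ≤
      ∑ i : Fin (K * K), (J i (pastBlocks m K x i)).cumLoss (fun a e => l a (g e))
        (blockData m K x i) + ((n : ℝ) ^ 2 - (m * K : ℝ) ^ 2) * lmax := by
  set c := (square m).card with hc
  have hcard : (square n).card = K * K * c + (n * n - m * K * (m * K)) := by
    have h1 : K * K * c = m * K * (m * K) := by rw [hc, card_square]; ring
    have h2 := Nat.mul_le_mul hKn hKn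
    rw [h1, card_square]
    omega
  let f (t : ℕ) : ℝ := if h : t < (square n).card then
    l (x (S.visit (fun v => x v) ⟨t, h⟩)) (S.predict (fun v => x v) ⟨t, h⟩) else 0
  have hf : S.cumLoss l (fun v => x v) = ∑ t ∈ Finset.range (square n).card, f t := by
    rw [Finset.sum_range]
    exact Finset.sum_congr rfl fun t _ => by simp [f]
  rw [hf, hcard, Finset.sum_range_add, sum_range_mul_eq, Finset.sum_range]
  refine add_le_add (le_of_eq ?_) ?_
  · refine Finset.sum_congr rfl fun i _ => ?_
    rw [Finset.sum_range]
    refine Finset.sum_congr rfl fun r _ => ?_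
    have ht : (i : ℕ) * c + r < (square n).card := by
      have : ((i : ℕ) + 1) * c ≤ K * K * c := Nat.mul_le_mul_right _ i.2
      rw [Nat.add_mul] at this
      omega
    have h := hS x i r ⟨i * c + r, ht⟩ rfl
    simp only [f, dif_pos ht]
    rw [h.1, h.2]
    rfl
  · refine (Finset.sum_le_card_nsmul _ _ lmax fun t ht => ?_).trans (le_of_eq ?_)
    · have ht' : K * K * c + t < (square n).card := by
        rw [hcard]; exact Nat.add_lt_add_left (Finset.mem_range.1 ht) _
      simp only [f, dif_pos ht']
      exact hl _ _
    · have h2 := Nat.mul_le_mul hKn hKn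
      rw [Finset.card_range, nsmul_eq_mul, Nat.cast_sub h2]
      push_cast
      ring

theorem sq_sub_sq_le (n : ℕ) {m : ℕ} (hm : 0 < m) :
    (n : ℝ) ^ 2 - (m * (n / m : ℕ) : ℝ) ^ 2 ≤ 2 * m * n := by
  have h1 : (m * (n / m : ℕ) : ℝ) ≤ n := by exact_mod_cast Nat.mul_div_le n m
  have h2 : (n : ℝ) ≤ m * (n / m : ℕ) + m := by
    have := Nat.div_add_mod n m
    have := Nat.mod_lt n hm
    have h : n ≤ m * (n / m) + m := by omega
    exact_mod_cast h
  have h3 : (0 : ℝ) ≤ m * (n / m : ℕ) := by positivity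
  nlinarith

end BlockLoss

/-! ### Expected loss -/

section Expectation

variable {A D E : Type*} [Finite A] [MeasurableSpace A] [MeasurableSingletonClass A]
  {Q : Measure (ℤ × ℤ → A)} {B : Finset (ℤ × ℤ)}

omit [Finite A] [MeasurableSingletonClass A] in
theorem measurable_restrict (B : Finset (ℤ × ℤ)) :
    Measurable (fun (x : ℤ × ℤ → A) (b : B) => x b) := by
  fun_prop

theorem integral_marginal (f : (B → A) → ℝ) :
    ∫ y, f y ∂(marginal Q B) = ∫ x, f (fun b => x b) ∂Q :=
  integral_map (measurable_restrict B).aemeasurable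
    (measurable_of_finite f).aestronglyMeasurable

omit [Finite A] [MeasurableSingletonClass A] in
theorem integrable_comp [IsFiniteMeasure Q] {β : Type*} [Finite β] [MeasurableSpace β]
    [MeasurableSingletonClass β] (f : β → ℝ) {φ : (ℤ × ℤ → A) → β} (hφ : Measurable φ) :
    Integrable (fun x => f (φ x)) Q :=
  (Integrable.of_finite (μ := Q.map φ) (f := f)).comp_measurable hφ

omit [Finite A] [MeasurableSingletonClass A] in
theorem measurable_blockData (m K i : ℕ) :
    Measurable (fun x : ℤ × ℤ → A => blockData m K x i) := by
  unfold blockData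
  fun_prop

/-- By stationarity, all blocks have the distribution of the block at the origin. -/
theorem IsStationary.integral_blockData (hQ : IsStationary Q) (m K i : ℕ)
    (f : (square m → A) → ℝ) :
    ∫ x, f (blockData m K x i) ∂Q = ∫ y, f y ∂(marginal Q (square m)) := by
  have hshift : Measurable (fun (x : ℤ × ℤ → A) (w : ℤ × ℤ) => x (w + blockCorner m K i)) := by
    fun_prop
  have hf : Measurable fun x : ℤ × ℤ → A => f (fun b => x b) :=
    (measurable_of_finite f).comp (measurable_restrict _)
  rw [integral_marginal]
  conv_rhs => rw [← hQ (blockCorner m K i)]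
  rw [integral_map hshift.aemeasurable hf.aestronglyMeasurable]
  refine integral_congr_ae (ae_of_all _ fun x => congrArg f ?_)
  funext v
  simp only [blockData, add_comm]

omit [Finite A] [MeasurableSingletonClass A] in
theorem scandictabilityOn_le {l : A → D → ℝ} (hl : ∀ a d, 0 ≤ l a d) (Q : Measure (ℤ × ℤ → A))
    (S : Scandictor A D B) :
    scandictabilityOn l Q B ≤ 1 / (B.card : ℝ) * ∫ y, S.cumLoss l y ∂(marginal Q B) := by
  rw [← integral_const_mul]
  refine ciInf_le (f := fun S : Scandictor A D B =>
    ∫ x, (1 / (B.card : ℝ)) * S.cumLoss l x ∂(marginal Q B)) ⟨0, ?_⟩ S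
  rintro _ ⟨T, rfl⟩
  exact integral_nonneg fun y => mul_nonneg (by positivity) (T.cumLoss_nonneg hl y)

omit [Finite A] [MeasurableSingletonClass A] in
theorem le_scandictabilityOn [Nonempty D] {l : A → D → ℝ} {r : ℝ}
    (h : ∀ S : Scandictor A D B, r ≤ 1 / (B.card : ℝ) * ∫ y, S.cumLoss l y ∂(marginal Q B)) :
    r ≤ scandictabilityOn l Q B := by
  refine le_ciInf fun S => ?_
  rw [integral_const_mul]
  exact h S

/-- The normalized loss on `V_n` of a scan that has expected loss `P` on each block, and a total
excess of at most `R`. -/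
theorem normalized_block_loss_le {n m : ℕ} (hm : 0 < m) {P R : ℝ} (hP : 0 ≤ P) :
    1 / ((square n).card : ℝ) * ((n / m : ℕ) * (n / m : ℕ) * P + R) ≤
      1 / ((square m).card : ℝ) * P + R / (n : ℝ) ^ 2 := by
  have hm' : (0 : ℝ) < m := by exact_mod_cast hm
  rw [card_square, card_square]
  push_cast
  rcases Nat.eq_zero_or_pos n with rfl | hn
  · simp; positivity
  have hn' : (0 : ℝ) < n := by exact_mod_cast hn
  have h1 : ((n / m : ℕ) : ℝ) ≤ n / m := Nat.cast_div_le
  have h2 : ((n / m : ℕ) : ℝ) * (n / m : ℕ) ≤ n / m * (n / m) := by gcongr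
  calc 1 / ((n : ℝ) * n) * ((n / m : ℕ) * (n / m : ℕ) * P + R)
      ≤ 1 / ((n : ℝ) * n) * (n / m * (n / m) * P + R) := by gcongr
    _ = 1 / ((m : ℝ) * m) * P + R / (n : ℝ) ^ 2 := by field_simp

/-- Scandictability on squares is almost monotone: a scandictor for `V_m` can be used on all blocks
of `V_n`. -/
theorem IsStationary.scandictabilityOn_square_le [IsProbabilityMeasure Q] (hQ : IsStationary Q)
    [Nonempty D] {l : A → D → ℝ} {lmax : ℝ} (hl0 : ∀ a d, 0 ≤ l a d) (hl : ∀ a d, l a d ≤ lmax)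
    (hlmax : 0 ≤ lmax) (n : ℕ) {m : ℕ} (hm : 0 < m) :
    scandictabilityOn l Q (square n) ≤
      scandictabilityOn l Q (square m) + 2 * m * n * lmax / (n : ℝ) ^ 2 := by
  rw [← sub_le_iff_le_add]
  refine le_scandictabilityOn fun S => ?_
  rw [sub_le_iff_le_add]
  obtain ⟨T, hT⟩ := exists_followsVia (Nat.mul_div_le n m) id
    (fun _ _ => S : Selection A D m (n / m * (n / m)))
  set P := ∫ y, S.cumLoss l y ∂(marginal Q (square m)) with hP
  have hint : ∫ y, T.cumLoss l y ∂(marginal Q (square n)) ≤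
      (n / m : ℕ) * (n / m : ℕ) * P + 2 * m * n * lmax := by
    rw [integral_marginal]
    have hblock (i : Fin (n / m * (n / m))) :
        Integrable (fun x => S.cumLoss l (blockData m (n / m) x i)) Q :=
      integrable_comp (S.cumLoss l) (measurable_blockData m (n / m) i)
    calc ∫ x, T.cumLoss l (fun v => x v) ∂Q
        ≤ ∫ x, (∑ i : Fin (n / m * (n / m)), S.cumLoss l (blockData m (n / m) x i) +
            2 * m * n * lmax) ∂Q := by
          refine integral_mono (integrable_comp (T.cumLoss l) (measurable_restrict _))
            ((integrable_finsetSum _ fun i _ => hblock i).add (integrable_const _)) fun x => ?_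
          refine (hT.cumLoss_le (Nat.mul_div_le n m) hl x).trans ?_
          have := mul_le_mul_of_nonneg_right (sq_sub_sq_le n hm) hlmax
          exact add_le_add le_rfl this
      _ = _ := by
          rw [integral_add (integrable_finsetSum _ fun i _ => hblock i) (integrable_const _),
            integral_finsetSum _ fun i _ => hblock i]
          simp [hQ.integral_blockData m (n / m) _ (S.cumLoss l), hP]
  calc scandictabilityOn l Q (square n)
      ≤ 1 / ((square n).card : ℝ) * ∫ y, T.cumLoss l y ∂(marginal Q (square n)) :=
        scandictabilityOn_le hl0 Q T
    _ ≤ 1 / ((square n).card : ℝ) * ((n / m : ℕ) * (n / m : ℕ) * P + 2 * m * n * lmax) := by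
        gcongr
    _ ≤ _ := normalized_block_loss_le hm (integral_nonneg fun y => S.cumLoss_nonneg hl0 y)

/-- A variant of Fekete's lemma; the limit is the infimum of `u` over positive indices. -/
theorem tendsto_of_almost_monotone {u : ℕ → ℝ} {C : ℝ} (h0 : ∀ n, 0 ≤ u n)
    (h : ∀ n m, 0 < m → u n ≤ u m + 2 * m * n * C / (n : ℝ) ^ 2) :
    ∃ L, Tendsto u atTop (𝓝 L) := by
  let v (m : ℕ) : ℝ := u (m + 1)
  have hbdd : BddBelow (Set.range v) := ⟨0, by rintro _ ⟨m, rfl⟩; exact h0 _⟩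
  refine ⟨⨅ m, v m, ?_⟩
  refine tendsto_order.2 ⟨fun a ha => ?_, fun a ha => ?_⟩
  · filter_upwards [eventually_ge_atTop 1] with n hn
    refine ha.trans_le ?_
    have := ciInf_le hbdd (n - 1)
    simpa [v, Nat.sub_add_cancel hn] using this
  · obtain ⟨m, hm⟩ := exists_lt_of_ciInf_lt ha
    have hlim : Tendsto (fun n : ℕ => v m + 2 * (m + 1 : ℕ) * C / (n : ℝ)) atTop
        (𝓝 (v m + 0)) :=
      tendsto_const_nhds.add (tendsto_const_div_atTop_nhds_zero_nat _)
    rw [add_zero] at hlim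
    filter_upwards [hlim.eventually_lt_const hm, eventually_gt_atTop 0] with n hn hn0
    refine lt_of_le_of_lt ((h n (m + 1) m.succ_pos).trans (le_of_eq ?_)) hn
    have : (n : ℝ) ≠ 0 := by exact_mod_cast hn0.ne'
    simp only [v]
    field_simp

/-- The limit that defines the scandictability of a stationary field exists. -/
theorem IsStationary.tendsto_scandictability [IsProbabilityMeasure Q] (hQ : IsStationary Q)
    [Nonempty D] {l : A → D → ℝ} {lmax : ℝ} (hl0 : ∀ a d, 0 ≤ l a d) (hl : ∀ a d, l a d ≤ lmax)
    (hlmax : 0 ≤ lmax) :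
    Tendsto (fun n : ℕ => scandictabilityOn l Q (square n)) atTop (𝓝 (scandictability l Q)) := by
  obtain ⟨L, hL⟩ := tendsto_of_almost_monotone (C := lmax)
    (u := fun n : ℕ => scandictabilityOn l Q (square n))
    (fun n => le_scandictabilityOn fun S =>
      mul_nonneg (by positivity) (integral_nonneg fun y => S.cumLoss_nonneg hl0 y))
    (fun n m hm => hQ.scandictabilityOn_square_le hl0 hl hlmax n hm)
  rwa [scandictability, hL.limUnder_eq]

end Expectation

/-! ### The regret of exponential weighting -/

section Hedge

/-- This replaces Hoeffding's lemma in the analysis of exponential weighting; it costs a constant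
factor in the regret. -/
theorem exp_neg_le_quadratic {x : ℝ} (hx : 0 ≤ x) : Real.exp (-x) ≤ 1 - x + x ^ 2 / 2 := by
  have h := Real.quadratic_le_exp_of_nonneg hx
  have h0 : 0 < 1 - x + x ^ 2 / 2 := by nlinarith [sq_nonneg (x - 1)]
  rw [Real.exp_neg, inv_le_comm₀ (Real.exp_pos x) h0]
  refine le_trans ?_ h
  rw [inv_le_iff_one_le_mul₀ h0]
  nlinarith [sq_nonneg (x ^ 2)]

variable {ι : Type*} [Fintype ι] [Nonempty ι]

/-- The weight of expert `j` after `i` rounds with the losses `ℓ`. -/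
noncomputable def hedgeWeight (η : ℝ) (ℓ : ℕ → ι → ℝ) (i : ℕ) (j : ι) : ℝ :=
  Real.exp (-η * ∑ k ∈ Finset.range i, ℓ k j) /
    ∑ j', Real.exp (-η * ∑ k ∈ Finset.range i, ℓ k j')

theorem sum_hedgeWeight (η : ℝ) (ℓ : ℕ → ι → ℝ) (i : ℕ) : ∑ j, hedgeWeight η ℓ i j = 1 := by
  simp only [hedgeWeight]
  rw [← Finset.sum_div]
  exact div_self (Finset.sum_pos (fun _ _ => Real.exp_pos _) Finset.univ_nonempty).ne'

theorem hedgeWeight_nonneg (η : ℝ) (ℓ : ℕ → ι → ℝ) (i : ℕ) (j : ι) : 0 ≤ hedgeWeight η ℓ i j := by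
  unfold hedgeWeight
  positivity

/-- The sum of the unnormalized weights decreases by a factor of at most
`exp (-η * w + η ^ 2 * M ^ 2 / 2)` in a round with mean loss `w`. -/
theorem sum_exp_le {η M : ℝ} (hη : 0 ≤ η) {ℓ : ℕ → ι → ℝ} (h0 : ∀ i j, 0 ≤ ℓ i j)
    (hM : ∀ i j, ℓ i j ≤ M) (N : ℕ) :
    ∑ j, Real.exp (-η * ∑ k ∈ Finset.range N, ℓ k j) ≤
      Fintype.card ι * Real.exp (-η * ∑ i ∈ Finset.range N, ∑ j, hedgeWeight η ℓ i j * ℓ i j +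
        N * (η ^ 2 * M ^ 2 / 2)) := by
  induction N with
  | zero => simp
  | succ N ih =>
    set W := ∑ j, Real.exp (-η * ∑ k ∈ Finset.range N, ℓ k j) with hW
    have hWpos : 0 < W := Finset.sum_pos (fun _ _ => Real.exp_pos _) Finset.univ_nonempty
    set a := ∑ j, hedgeWeight η ℓ N j * ℓ N j with ha
    have hstep : ∑ j, Real.exp (-η * ∑ k ∈ Finset.range (N + 1), ℓ k j) ≤
        W * Real.exp (-η * a + η ^ 2 * M ^ 2 / 2) := by
      calc ∑ j, Real.exp (-η * ∑ k ∈ Finset.range (N + 1), ℓ k j)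
          = W * ∑ j, hedgeWeight η ℓ N j * Real.exp (-(η * ℓ N j)) := by
            rw [Finset.mul_sum]
            refine Finset.sum_congr rfl fun j _ => ?_
            rw [Finset.sum_range_succ, mul_add, Real.exp_add, hedgeWeight, ← hW, neg_mul,
              neg_mul]
            field_simp
        _ ≤ W * ∑ j, hedgeWeight η ℓ N j * (1 - η * ℓ N j + η ^ 2 * M ^ 2 / 2) := by
            refine mul_le_mul_of_nonneg_left (Finset.sum_le_sum fun j _ =>
              mul_le_mul_of_nonneg_left ?_ (hedgeWeight_nonneg _ _ _ _)) hWpos.le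
            refine (exp_neg_le_quadratic (mul_nonneg hη (h0 N j))).trans ?_
            have h2 : (ℓ N j) ^ 2 ≤ M ^ 2 := pow_le_pow_left₀ (h0 N j) (hM N j) 2
            have := mul_le_mul_of_nonneg_left h2 (sq_nonneg η)
            rw [mul_pow]
            linarith
        _ = W * ((-η * a + η ^ 2 * M ^ 2 / 2) + 1) := by
            have h (j : ι) : hedgeWeight η ℓ N j * (1 - η * ℓ N j + η ^ 2 * M ^ 2 / 2) =
                hedgeWeight η ℓ N j * (1 + η ^ 2 * M ^ 2 / 2) -
                  η * (hedgeWeight η ℓ N j * ℓ N j) := by ring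
            simp only [h]
            rw [Finset.sum_sub_distrib, ← Finset.sum_mul, ← Finset.mul_sum, sum_hedgeWeight, ← ha]
            ring
        _ ≤ _ := mul_le_mul_of_nonneg_left (Real.add_one_le_exp _) hWpos.le
    refine hstep.trans ((mul_le_mul_of_nonneg_right ih (Real.exp_pos _).le).trans (le_of_eq ?_))
    rw [mul_assoc, ← Real.exp_add, Finset.sum_range_succ, ← ha]
    push_cast
    congr 2
    ring

/-- The total mean loss of exponential weighting against that of expert `j`. The inequality is
multiplied by `η`, so that it also makes sense for `η = 0`. -/
theorem hedge_regret {η M : ℝ} (hη : 0 ≤ η) {ℓ : ℕ → ι → ℝ} (h0 : ∀ i j, 0 ≤ ℓ i j)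
    (hM : ∀ i j, ℓ i j ≤ M) (N : ℕ) (j : ι) :
    η * ∑ i ∈ Finset.range N, ∑ j, hedgeWeight η ℓ i j * ℓ i j ≤
      η * ∑ i ∈ Finset.range N, ℓ i j + Real.log (Fintype.card ι) +
        N * (η ^ 2 * M ^ 2 / 2) := by
  have h1 : Real.exp (-η * ∑ k ∈ Finset.range N, ℓ k j) ≤ _ :=
    (Finset.single_le_sum (f := fun j => Real.exp (-η * ∑ k ∈ Finset.range N, ℓ k j))
      (fun _ _ => (Real.exp_pos _).le) (Finset.mem_univ j)).trans (sum_exp_le hη h0 hM N)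
  have hcard : (0 : ℝ) < Fintype.card ι := by exact_mod_cast Fintype.card_pos
  have h2 := Real.log_le_log (Real.exp_pos _) h1
  rw [Real.log_exp, Real.log_mul hcard.ne' (Real.exp_pos _).ne', Real.log_exp] at h2
  linarith

/-- The regret for the learning rate `learningRate`, with `K * K` blocks of size `m × m` in `V_n`. -/
theorem hedge_learningRate_regret {lmax : ℝ} (hlmax : 0 ≤ lmax) {n m K : ℕ} (hm : 0 < m)
    (hK : m * K ≤ n) {ℓ : ℕ → ι → ℝ} (h0 : ∀ i j, 0 ≤ ℓ i j)
    (hM : ∀ i j, ℓ i j ≤ m * m * lmax) (j : ι) :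
    ∑ i ∈ Finset.range (K * K), ∑ j,
        hedgeWeight (learningRate lmax (Fintype.card ι) n m) ℓ i j * ℓ i j ≤
      ∑ i ∈ Finset.range (K * K), ℓ i j +
        2 * (lmax * m * (n + m)) * √(Real.log (Fintype.card ι)) := by
  have hm' : (0 : ℝ) < m := by exact_mod_cast hm
  have hlog : 0 ≤ Real.log (Fintype.card ι) := Real.log_natCast_nonneg _
  rcases hlmax.eq_or_lt with rfl | hpos
  -- All losses vanish.
  · have hz : ∀ i j, ℓ i j = 0 := fun i j => le_antisymm (by simpa using hM i j) (h0 i j)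
    simp [hz]
  rcases hlog.eq_or_lt with hz | hlogpos
  -- There is only one expert.
  · have hcard : Fintype.card ι ≤ 1 := by
      by_contra h
      push Not at h
      exact (Real.log_pos (by exact_mod_cast h)).ne hz
    have hsub : Subsingleton ι := Fintype.card_le_one_iff_subsingleton.1 hcard
    have hw (i : ℕ) : ∑ j', hedgeWeight (learningRate lmax (Fintype.card ι) n m) ℓ i j' * ℓ i j' =
        ℓ i j := by
      have h1 (j' : ι) : hedgeWeight (learningRate lmax (Fintype.card ι) n m) ℓ i j' * ℓ i j' =
          hedgeWeight (learningRate lmax (Fintype.card ι) n m) ℓ i j' * ℓ i j := by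
        rw [Subsingleton.elim j' j]
      simp only [h1]
      rw [← Finset.sum_mul, sum_hedgeWeight, one_mul]
    simp only [hw, ← hz]
    simp
  set s := √(Real.log (Fintype.card ι)) with hs
  set T := lmax * m * (n + m) with hT
  have hspos : 0 < s := Real.sqrt_pos.2 hlogpos
  have hTpos : 0 < T := by positivity
  have hs2 : s ^ 2 = Real.log (Fintype.card ι) := Real.sq_sqrt hlog
  have h8 : √8 ^ 2 = (8 : ℝ) := Real.sq_sqrt (by norm_num)
  have h8pos : 0 < √(8 : ℝ) := by positivity
  have hη : learningRate lmax (Fintype.card ι) n m = √8 * s / T := by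
    rw [learningRate, Real.sqrt_mul (by norm_num)]
  set η := learningRate lmax (Fintype.card ι) n m
  have hηpos : 0 < η := by rw [hη]; positivity
  have hreg := hedge_regret hηpos.le h0 hM (K * K) j
  refine le_of_mul_le_mul_left (hreg.trans ?_) hηpos
  rw [mul_add, add_assoc, ← hs2]
  refine add_le_add le_rfl ?_
  -- `K * K` blocks of size `m × m` fit into `V_n`.
  have hsize : (K * K : ℕ) * (m * m * lmax) ^ 2 ≤ T ^ 2 := by
    have h1 : (m * K : ℝ) ≤ n + m := by
      have : (m * K : ℝ) ≤ n := by exact_mod_cast hK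
      linarith
    have h2 : (m * K : ℝ) ^ 2 ≤ (n + m) ^ 2 := pow_le_pow_left₀ (by positivity) h1 2
    have h3 := mul_le_mul_of_nonneg_left h2 (sq_nonneg (lmax * m))
    rw [hT]
    push_cast
    linarith
  have h2s : η * (2 * T * s) = 2 * √8 * s ^ 2 := by
    rw [hη]; field_simp
  have hη2 : η ^ 2 * T ^ 2 = 8 * s ^ 2 := by
    rw [hη, div_pow, mul_pow, h8]; field_simp
  have hquad : (K * K : ℕ) * (η ^ 2 * (m * m * lmax) ^ 2 / 2) ≤ 4 * s ^ 2 := by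
    have := mul_le_mul_of_nonneg_left hsize (sq_nonneg η)
    linarith
  have h8' : 5 / 2 ≤ √(8 : ℝ) := Real.le_sqrt_of_sq_le (by norm_num)
  rw [h2s]
  nlinarith [sq_nonneg s]

end Hedge

/-! ### Independent choices -/

section Product

/-- The distribution of a family of independent choices, `f i` being drawn from `p i`. -/
noncomputable def piPMF {ι : Type*} [Finite ι] {β : ι → Type*} [∀ i, Finite (β i)]
    (p : ∀ i, PMF (β i)) : PMF (∀ i, β i) :=
  haveI := Fintype.ofFinite (∀ i, β i)
  PMF.ofFintype (fun f => ∏ᶠ i, p i (f i)) (by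
    classical
    have := Fintype.ofFinite ι
    have (i : ι) := Fintype.ofFinite (β i)
    simp only [finprod_eq_prod_of_fintype]
    rw [← Finset.prod_eq_one (s := Finset.univ) (f := fun i => ∑ b, p i b),
      Finset.prod_univ_sum, Fintype.piFinset_univ]
    · exact Finset.sum_congr (by ext; simp) fun _ _ => rfl
    · intro i _
      have h := (p i).tsum_coe
      rwa [tsum_fintype] at h)

theorem piPMF_toOuterMeasure {ι : Type*} [Fintype ι] {β : ι → Type*} [∀ i, Finite (β i)]
    (p : ∀ i, PMF (β i)) (s : ∀ i, Set (β i)) :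
    (piPMF p).toOuterMeasure {f | ∀ i, f i ∈ s i} = ∏ i, (p i).toOuterMeasure (s i) := by
  classical
  have (i : ι) := Fintype.ofFinite (β i)
  have happly (f : ∀ i, β i) : piPMF p f = ∏ i, p i (f i) :=
    finprod_eq_prod_of_fintype fun i => p i (f i)
  simp only [PMF.toOuterMeasure_apply_fintype]
  rw [Finset.prod_univ_sum, Fintype.piFinset_univ]
  refine Finset.sum_congr rfl fun f _ => ?_
  by_cases h : ∀ i, f i ∈ s i
  · rw [Set.indicator_of_mem (by exact h), happly]
    refine Finset.prod_congr rfl fun i _ => ?_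
    rw [Set.indicator_of_mem (h i)]
  · rw [Set.indicator_of_notMem (by exact h)]
    push Not at h
    obtain ⟨i, hi⟩ := h
    exact (Finset.prod_eq_zero (Finset.mem_univ i) (Set.indicator_of_notMem hi _)).symm

theorem piPMF_toOuterMeasure_eval {ι : Type*} [Finite ι] {β : ι → Type*} [∀ i, Finite (β i)]
    (p : ∀ i, PMF (β i)) (i : ι) (s : Set (β i)) :
    (piPMF p).toOuterMeasure {f | f i ∈ s} = (p i).toOuterMeasure s := by
  classical
  have := Fintype.ofFinite ι
  have hset : {f : ∀ i, β i | f i ∈ s} =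
      {f | ∀ k, f k ∈ (Function.update (fun k => (Set.univ : Set (β k))) i s) k} := by
    ext f
    simp only [Set.mem_ofPred_eq]
    refine ⟨fun h k => ?_, fun h => by simpa using h i⟩
    rcases eq_or_ne k i with rfl | hk
    · simpa using h
    · simp [hk]
  rw [hset, piPMF_toOuterMeasure, Finset.prod_eq_single i]
  · simp
  · intro k _ hk
    rw [Function.update_of_ne hk]
    exact (PMF.toOuterMeasure_apply_eq_one_iff _ _).2 (Set.subset_univ _)
  · simp

theorem piPMF_map_eval {ι : Type*} [Finite ι] {β : ι → Type*} [∀ i, Finite (β i)]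
    (p : ∀ i, PMF (β i)) (i : ι) : (piPMF p).map (fun f => f i) = p i := by
  ext b
  rw [← PMF.toOuterMeasure_apply_singleton, ← PMF.toOuterMeasure_apply_singleton,
    PMF.toOuterMeasure_map_apply]
  exact piPMF_toOuterMeasure_eval p i {b}

/-- The expectation of `φ` under an image of `μ`; the sum over `β` has finite support. -/
theorem tsum_map_toReal_mul {α β : Type*} [Fintype α] (μ : PMF α) (f : α → β) (φ : β → ℝ) :
    ∑' b, (μ.map f b).toReal * φ b = ∑ a, (μ a).toReal * φ (f a) := by
  classical
  have hmap (b : β) : (μ.map f b).toReal = ∑ a, if b = f a then (μ a).toReal else 0 := by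
    rw [PMF.map_apply, tsum_fintype, ENNReal.toReal_sum]
    · refine Finset.sum_congr rfl fun a _ => ?_
      split_ifs <;> simp
    · intro a _
      split_ifs
      · exact μ.apply_ne_top a
      · simp
  rw [tsum_eq_sum (s := Finset.univ.image f)]
  · simp only [hmap, Finset.sum_mul]
    rw [Finset.sum_comm]
    refine Finset.sum_congr rfl fun a _ => ?_
    rw [Finset.sum_eq_single (f a)]
    · simp
    · intro b _ hb
      simp [hb]
    · simp
  · intro b hb
    rw [hmap, Finset.sum_eq_zero, zero_mul]
    intro a _
    rw [if_neg]
    rintro rfl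
    exact hb (Finset.mem_image_of_mem f (Finset.mem_univ a))

end Product

/-! ### Block-wise exponential weighting -/

section ExpWeighting

variable {A D E : Type*} [Finite A] [Finite E] [Nonempty E]

omit [Nonempty E] in
theorem expWeight_eq_hedgeWeight (l : A → E → ℝ) (η : ℝ) (m K : ℕ) (x : ℤ × ℤ → A) (i : ℕ)
    (j : Scandictor A E (square m)) :
    expWeight l η (pastBlocks m K x i) j =
      hedgeWeight η (fun i (j : Scandictor A E (square m)) => j.cumLoss l (blockData m K x i)) i j := by
  simp only [expWeight, hedgeWeight, pastBlocks, Finset.sum_range]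

omit [Nonempty E] in
theorem expWeight_nonneg {B : Finset (ℤ × ℤ)} (l : A → E → ℝ) (η : ℝ) {i : ℕ}
    (y : Fin i → B → A) (j : Scandictor A E B) : 0 ≤ expWeight l η y j := by
  unfold expWeight
  positivity

/-- The exponential weights as a distribution on the scandictors for a block. -/
noncomputable def expPMF {B : Finset (ℤ × ℤ)} (l : A → E → ℝ) (η : ℝ) {i : ℕ}
    (y : Fin i → B → A) : PMF (Scandictor A E B) :=
  PMF.ofFintype (fun j => ENNReal.ofReal (expWeight l η y j)) (by
    rw [← ENNReal.ofReal_sum_of_nonneg fun j _ => expWeight_nonneg l η y j]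
    simp only [expWeight]
    rw [← Finset.sum_div, div_self, ENNReal.ofReal_one]
    exact (Finset.sum_pos (fun _ _ => Real.exp_pos _) Finset.univ_nonempty).ne')

theorem toReal_expPMF {B : Finset (ℤ × ℤ)} (l : A → E → ℝ) (η : ℝ) {i : ℕ}
    (y : Fin i → B → A) (j : Scandictor A E B) : (expPMF l η y j).toReal = expWeight l η y j :=
  ENNReal.toReal_ofReal (expWeight_nonneg l η y j)

noncomputable instance (m N : ℕ) : Fintype (Selection A E m N) :=
  Fintype.ofFinite _

/-- The random selection rule of exponential weighting: for every block and all data in the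
preceding blocks, a scandictor is drawn according to the exponential weights, independently. -/
noncomputable def selectionPMF (l : A → E → ℝ) (η : ℝ) (m N : ℕ) : PMF (Selection A E m N) :=
  piPMF fun i : Fin N => piPMF fun y : Fin i → square m → A => expPMF l η y

/-- For fixed past data `y`, the choices for the blocks are independent, with the exponential
weights as their laws. -/
theorem selectionPMF_toOuterMeasure (l : A → E → ℝ) (η : ℝ) {m N : ℕ}
    (y : ∀ i : Fin N, Fin i → square m → A) (j : Fin N → Scandictor A E (square m)) :
    (selectionPMF l η m N).toOuterMeasure {J | ∀ i, J i (y i) = j i} =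
      ENNReal.ofReal (∏ i, expWeight l η (y i) (j i)) := by
  rw [ENNReal.ofReal_prod_of_nonneg fun i _ => expWeight_nonneg l η _ _]
  refine (piPMF_toOuterMeasure
    (fun i : Fin N => piPMF fun y : Fin i → square m → A => expPMF l η y)
    (fun i => {c | c (y i) ∈ ({j i} : Set (Scandictor A E (square m)))})).trans
    (Finset.prod_congr rfl fun i _ => ?_)
  rw [piPMF_toOuterMeasure_eval, PMF.toOuterMeasure_apply_singleton]
  rfl

theorem sum_selectionPMF (l : A → E → ℝ) (η : ℝ) {m N : ℕ} (i : Fin N)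
    (y : Fin i → square m → A) (φ : Scandictor A E (square m) → ℝ) :
    ∑ J, ((selectionPMF l η m N) J).toReal * φ (J i y) = ∑ j, expWeight l η y j * φ j := by
  have hmap : (selectionPMF l η m N).map (fun J => J i y) = expPMF l η y := by
    have h := congrArg (PMF.map fun c => c y) (piPMF_map_eval
      (fun i : Fin N => piPMF fun y : Fin i → square m → A => expPMF l η y) i)
    rw [PMF.map_comp] at h
    exact h.trans (piPMF_map_eval _ y)
  rw [← tsum_map_toReal_mul (selectionPMF l η m N) (fun J => J i y) φ, hmap, tsum_fintype]
  simp only [toReal_expPMF]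

theorem sum_toReal_eq_one {α : Type*} [Fintype α] (μ : PMF α) : ∑ a, (μ a).toReal = 1 := by
  rw [← ENNReal.toReal_sum fun a _ => μ.apply_ne_top a, ← tsum_fintype (L := .unconditional _),
    μ.tsum_coe, ENNReal.toReal_one]

/-- On every array, block-wise exponential weighting is almost as good as any single scandictor for
the blocks. -/
theorem meanLoss_selectionPMF_le {n m : ℕ} (hm : 0 < m) {l : A → D → ℝ} {lmax : ℝ}
    (hl0 : ∀ a d, 0 ≤ l a d) (hl : ∀ a d, l a d ≤ lmax) (hlmax : 0 ≤ lmax) (g : E → D)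
    {S : Selection A E m (n / m * (n / m)) → Scandictor A D (square n)}
    (hS : ∀ J, FollowsVia g (S J) J) (x : ℤ × ℤ → A) (j : Scandictor A E (square m)) :
    RandomizedScandictor.meanLoss l ((selectionPMF (fun a e => l a (g e))
      (learningRate lmax (Fintype.card (Scandictor A E (square m))) n m) m
        (n / m * (n / m))).map S) (fun v => x v) ≤
      ∑ i : Fin (n / m * (n / m)), j.cumLoss (fun a e => l a (g e)) (blockData m (n / m) x i) +
        (2 * (lmax * m * (n + m)) *
          √(Real.log (Fintype.card (Scandictor A E (square m)))) + 2 * m * n * lmax) := by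
  have hKn : m * (n / m) ≤ n := Nat.mul_div_le n m
  set η := learningRate lmax (Fintype.card (Scandictor A E (square m))) n m with hη
  set l' : A → E → ℝ := fun a e => l a (g e) with hl'
  set μ := selectionPMF l' η m (n / m * (n / m)) with hμ
  have hcov := mul_le_mul_of_nonneg_right (sq_sub_sq_le n hm) hlmax
  have h1 : RandomizedScandictor.meanLoss l (μ.map S) (fun v => x v) ≤
      ∑ J, (μ J).toReal * (∑ i : Fin (n / m * (n / m)),
        (J i (pastBlocks m (n / m) x i)).cumLoss l' (blockData m (n / m) x i) + 2 * m * n * lmax) := by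
    rw [RandomizedScandictor.meanLoss,
      tsum_map_toReal_mul μ S (fun T => T.cumLoss l (fun v => x v))]
    refine Finset.sum_le_sum fun J _ => mul_le_mul_of_nonneg_left ?_ ENNReal.toReal_nonneg
    exact ((hS J).cumLoss_le hKn hl x).trans (add_le_add le_rfl hcov)
  have h2 : ∑ J, (μ J).toReal * (∑ i : Fin (n / m * (n / m)),
        (J i (pastBlocks m (n / m) x i)).cumLoss l' (blockData m (n / m) x i) + 2 * m * n * lmax) =
      ∑ i : Fin (n / m * (n / m)), ∑ j', expWeight l' η (pastBlocks m (n / m) x i) j' *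
        j'.cumLoss l' (blockData m (n / m) x i) + 2 * m * n * lmax := by
    simp only [mul_add, Finset.sum_add_distrib, Finset.mul_sum]
    rw [Finset.sum_comm, ← Finset.sum_mul, sum_toReal_eq_one, one_mul]
    congr 1
    refine Finset.sum_congr rfl fun i _ => ?_
    exact sum_selectionPMF l' η i (pastBlocks m (n / m) x i)
      (fun j' => j'.cumLoss l' (blockData m (n / m) x i))
  have h3 := hedge_learningRate_regret hlmax hm hKn
    (ℓ := fun i (j : Scandictor A E (square m)) => j.cumLoss l' (blockData m (n / m) x i))
    (fun i j => j.cumLoss_nonneg (fun a e => hl0 a (g e)) _)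
    (fun i j => (j.cumLoss_le (fun a e => hl a (g e)) _).trans (by rw [card_square]; simp)) j
  refine h1.trans (h2.le.trans ?_)
  simp only [expWeight_eq_hedgeWeight]
  rw [Finset.sum_range, Finset.sum_range] at h3
  linarith

end ExpWeighting

section Bounds

variable {A D : Type*} [Finite A] [MeasurableSpace A] [MeasurableSingletonClass A]
  {Q : Measure (ℤ × ℤ → A)} [IsProbabilityMeasure Q]

/-- A randomized scandictor is not better than the best scandictor. -/
theorem scandictabilityOn_le_meanLoss {B : Finset (ℤ × ℤ)} {l : A → D → ℝ}
    (hl0 : ∀ a d, 0 ≤ l a d) {α : Type*} [Fintype α] (μ : PMF α) (S : α → Scandictor A D B) :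
    scandictabilityOn l Q B ≤ ∫ x, 1 / (B.card : ℝ) *
      RandomizedScandictor.meanLoss l (μ.map S) x ∂(marginal Q B) := by
  have : IsProbabilityMeasure (marginal Q B) :=
    Measure.isProbabilityMeasure_map (measurable_restrict B).aemeasurable
  have hmean (x : B → A) : RandomizedScandictor.meanLoss l (μ.map S) x =
      ∑ a, (μ a).toReal * (S a).cumLoss l x :=
    tsum_map_toReal_mul μ S fun T => T.cumLoss l x
  simp only [hmean]
  rw [integral_const_mul, integral_finsetSum _ fun a _ => Integrable.of_finite]
  simp only [integral_const_mul]
  calc scandictabilityOn l Q B = ∑ a, (μ a).toReal * scandictabilityOn l Q B := by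
        rw [← Finset.sum_mul, sum_toReal_eq_one, one_mul]
    _ ≤ ∑ a, (μ a).toReal * (1 / (B.card : ℝ) * ∫ y, (S a).cumLoss l y ∂(marginal Q B)) :=
        Finset.sum_le_sum fun a _ => mul_le_mul_of_nonneg_left (scandictabilityOn_le hl0 Q (S a))
          ENNReal.toReal_nonneg
    _ = _ := by
        rw [Finset.mul_sum]
        exact Finset.sum_congr rfl fun a _ => by ring

/-- The expected loss of block-wise exponential weighting, when every prediction can be replaced by
one in `E` at the price `ε`. -/
theorem IsStationary.meanLoss_selectionPMF_le (hQ : IsStationary Q) {E : Type*} [Finite E]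
    [Nonempty E] [Nonempty D] {n m : ℕ} (hm : 0 < m) {l : A → D → ℝ} {lmax : ℝ}
    (hl0 : ∀ a d, 0 ≤ l a d) (hl : ∀ a d, l a d ≤ lmax) (hlmax : 0 ≤ lmax) (g : E → D) {ε : ℝ}
    (hε : ∀ d, ∃ e, ∀ a, |l a d - l a (g e)| ≤ ε)
    {S : Selection A E m (n / m * (n / m)) → Scandictor A D (square n)}
    (hS : ∀ J, FollowsVia g (S J) J) :
    ∫ x, 1 / ((square n).card : ℝ) * RandomizedScandictor.meanLoss l
        ((selectionPMF (fun a e => l a (g e))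
        (learningRate lmax (Fintype.card (Scandictor A E (square m))) n m) m
        (n / m * (n / m))).map S) x ∂(marginal Q (square n)) ≤
      scandictabilityOn l Q (square m) + ε +
        (2 * (lmax * m * (n + m)) *
          √(Real.log (Fintype.card (Scandictor A E (square m)))) + 2 * m * n * lmax) /
          (n : ℝ) ^ 2 := by
  set C := 2 * (lmax * m * (n + m)) *
    √(Real.log (Fintype.card (Scandictor A E (square m)))) + 2 * m * n * lmax
  set R := (selectionPMF (fun a e => l a (g e))
    (learningRate lmax (Fintype.card (Scandictor A E (square m))) n m) m
    (n / m * (n / m))).map S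
  have : IsProbabilityMeasure (marginal Q (square m)) :=
    Measure.isProbabilityMeasure_map (measurable_restrict _).aemeasurable
  rw [integral_const_mul, add_assoc, add_comm ε, ← add_assoc, ← sub_le_iff_le_add,
    ← sub_le_iff_le_add]
  refine le_scandictabilityOn fun T => ?_
  rw [sub_le_iff_le_add, sub_le_iff_le_add]
  choose q hq using hε
  -- The scandictor `T` with its predictions rounded to `E`.
  set j := T.mapPredict q
  set l' : A → E → ℝ := fun a e => l a (g e)
  set P := ∫ y, j.cumLoss l' y ∂(marginal Q (square m)) with hP
  have hround : 1 / ((square m).card : ℝ) * P ≤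
      1 / ((square m).card : ℝ) * ∫ y, T.cumLoss l y ∂(marginal Q (square m)) + ε := by
    have hcard : (0 : ℝ) < (square m).card := by
      rw [card_square]; exact_mod_cast Nat.mul_pos hm hm
    have h1 : P ≤ ∫ y, (T.cumLoss l y + (square m).card * ε) ∂(marginal Q (square m)) := by
      refine integral_mono Integrable.of_finite Integrable.of_finite fun y => ?_
      calc j.cumLoss l' y ≤ ∑ t : Fin (square m).card, (l (y (T.visit y t)) (T.predict y t) + ε) :=
            Finset.sum_le_sum fun t _ => by
              have := (abs_le.1 (hq (T.predict y t) (y (T.visit y t)))).1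
              change l (y (T.visit y t)) (g (q (T.predict y t))) ≤ _
              linarith
        _ = _ := by simp [Finset.sum_add_distrib, Scandictor.cumLoss]
    rw [integral_add Integrable.of_finite Integrable.of_finite] at h1
    simp only [integral_const, probReal_univ, one_smul] at h1
    calc _ ≤ 1 / ((square m).card : ℝ) *
          (∫ y, T.cumLoss l y ∂(marginal Q (square m)) + (square m).card * ε) := by gcongr
      _ = _ := by field_simp
  have hint : ∫ y, RandomizedScandictor.meanLoss l R y ∂(marginal Q (square n)) ≤
      (n / m : ℕ) * (n / m : ℕ) * P + C := by
    rw [integral_marginal]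
    have hblock (i : Fin (n / m * (n / m))) :
        Integrable (fun x => j.cumLoss l' (blockData m (n / m) x i)) Q :=
      integrable_comp (j.cumLoss l') (measurable_blockData m (n / m) i)
    calc ∫ x, RandomizedScandictor.meanLoss l R (fun v => x v) ∂Q
        ≤ ∫ x, (∑ i : Fin (n / m * (n / m)), j.cumLoss l' (blockData m (n / m) x i) + C) ∂Q :=
          integral_mono (integrable_comp (RandomizedScandictor.meanLoss l R)
            (measurable_restrict _))
            ((integrable_finsetSum _ fun i _ => hblock i).add (integrable_const _)) fun x =>
            Scandiction.meanLoss_selectionPMF_le hm hl0 hl hlmax g hS x j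
      _ = _ := by
          rw [integral_add (integrable_finsetSum _ fun i _ => hblock i) (integrable_const _),
            integral_finsetSum _ fun i _ => hblock i]
          simp [hQ.integral_blockData m (n / m) _ (j.cumLoss l'), hP]
  calc 1 / ((square n).card : ℝ) * _
      ≤ 1 / ((square n).card : ℝ) * ((n / m : ℕ) * (n / m : ℕ) * P + C) := by gcongr
    _ ≤ 1 / ((square m).card : ℝ) * P + C / (n : ℝ) ^ 2 := normalized_block_loss_le hm
        (integral_nonneg fun y => j.cumLoss_nonneg (fun a e => hl0 a (g e)) y)
    _ ≤ _ := by linarith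

end Bounds

/-! ### Rounding the predictions -/

/-- Predictions can be rounded to polynomially many ones: since `A` is finite, it is enough to round
the vectors `(l a d)_a` to a grid. -/
theorem exists_rounding {A D : Type*} [Finite A] [Nonempty D] (l : A → D → ℝ) (lmax : ℝ)
    (hl0 : ∀ a d, 0 ≤ l a d) (hl : ∀ a d, l a d ≤ lmax) :
    ∃ G : ℕ → Finset D, (Finite D → ∀ k, (G k : Set D) = Set.univ) ∧
      (∀ k, (G k).Nonempty) ∧
      (∀ k : ℕ, 0 < k → ∀ d, ∃ d' ∈ G k, ∀ a, |l a d - l a d'| ≤ 1 / (k : ℝ) ^ 4) ∧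
      ∃ C p : ℕ, ∀ k, (G k).card ≤ C * (k + 1) ^ p := by
  classical
  have := Fintype.ofFinite A
  by_cases hD : Finite D
  · have := Fintype.ofFinite D
    refine ⟨fun _ => Finset.univ, fun _ _ => by simp, fun _ => Finset.univ_nonempty,
      fun k _ d => ⟨d, Finset.mem_univ d, fun a => ?_⟩, Fintype.card D, 0, fun k => by simp⟩
    rw [sub_self, abs_zero]
    positivity
  let M (k : ℕ) : ℕ := ⌈lmax⌉₊ * k ^ 4
  have hM (k : ℕ) (a : A) (d : D) : ⌊l a d * (k : ℝ) ^ 4⌋₊ < M k + 1 := by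
    refine Nat.lt_succ_of_le (Nat.floor_le_of_le ?_)
    push_cast [M]
    gcongr
    exact (hl a d).trans (Nat.le_ceil _)
  let q (k : ℕ) (d : D) : A → Fin (M k + 1) := fun a => ⟨_, hM k a d⟩
  refine ⟨fun k => Finset.univ.image (Function.invFun (q k)), fun h => (hD h).elim,
    fun k => Finset.univ_nonempty.image _, fun k hk d => ?_,
    (⌈lmax⌉₊ + 1) ^ Fintype.card A, 4 * Fintype.card A, fun k => ?_⟩
  · refine ⟨Function.invFun (q k) (q k d), Finset.mem_image_of_mem _ (Finset.mem_univ _),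
      fun a => ?_⟩
    have hq : q k (Function.invFun (q k) (q k d)) = q k d := Function.invFun_eq ⟨d, rfl⟩
    set d' := Function.invFun (q k) (q k d)
    have hfl : ⌊l a d' * (k : ℝ) ^ 4⌋₊ = ⌊l a d * (k : ℝ) ^ 4⌋₊ :=
      congrArg Fin.val (congrFun hq a)
    have hk' : (0 : ℝ) < (k : ℝ) ^ 4 := by positivity
    have h1 := Nat.floor_le (mul_nonneg (hl0 a d) hk'.le)
    have h2 := Nat.lt_floor_add_one (l a d * (k : ℝ) ^ 4)
    have h3 := Nat.floor_le (mul_nonneg (hl0 a d') hk'.le)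
    have h4 := Nat.lt_floor_add_one (l a d' * (k : ℝ) ^ 4)
    rw [hfl] at h3 h4
    rw [le_div_iff₀ hk', ← abs_of_pos hk', ← abs_mul, sub_mul, abs_le]
    constructor <;> linarith
  · refine Finset.card_image_le.trans ?_
    rw [Finset.card_univ, Fintype.card_fun, Fintype.card_fin, pow_mul, ← mul_pow]
    refine Nat.pow_le_pow_left ?_ _
    have h1 : k ^ 4 ≤ (k + 1) ^ 4 := Nat.pow_le_pow_left (Nat.le_succ k) 4
    have h2 : 1 ≤ (k + 1) ^ 4 := Nat.one_le_pow _ _ k.succ_pos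
    calc ⌈lmax⌉₊ * k ^ 4 + 1 ≤ ⌈lmax⌉₊ * (k + 1) ^ 4 + (k + 1) ^ 4 := by gcongr
      _ = _ := by ring

/-! ### The regret is negligible -/

/-- The logarithm of the number of scandictors for `m × m` blocks is at most a power of
`exp (m ^ 2)`. The factor `|A| ^ (m ^ 2)` dominates; all others are estimated crudely. -/
theorem log_card_scandictor_le {A D : Type*} [Finite A] [Nonempty A] {G : ℕ → Finset D}
    (hG : ∀ k, (G k).Nonempty) {C p : ℕ} (hcard : ∀ k, (G k).card ≤ C * (k + 1) ^ p) (m : ℕ) :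
    Real.log (Fintype.card (Scandictor A (G m) (square m))) ≤
      C * Real.exp ((m : ℝ) ^ 2) ^ (p + Nat.card A + 2) := by
  have : Nonempty (G m) := (hG m).to_subtype
  set e := Real.exp ((m : ℝ) ^ 2) with he
  have hb : ((square m).card : ℝ) = (m : ℝ) ^ 2 := by rw [card_square]; push_cast; ring
  have hbe : ((square m).card : ℝ) ≤ e := by
    rw [hb]; linarith [Real.add_one_le_exp ((m : ℝ) ^ 2)]
  have hm2 : (m : ℝ) ≤ (m : ℝ) ^ 2 := by exact_mod_cast Nat.le_self_pow two_ne_zero m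
  have hme : (m : ℝ) + 1 ≤ e :=
    (Real.add_one_le_exp _).trans (Real.exp_le_exp.2 hm2)
  have hg : ((G m).card : ℝ) ≤ C * e ^ p := by
    calc ((G m).card : ℝ) ≤ C * ((m : ℝ) + 1) ^ p := by exact_mod_cast hcard m
      _ ≤ C * e ^ p := by gcongr
  have ha : (Nat.card A : ℝ) ^ (square m).card ≤ e ^ Nat.card A := by
    calc (Nat.card A : ℝ) ^ (square m).card ≤ Real.exp (Nat.card A) ^ (square m).card := by
          gcongr
          linarith [Real.add_one_le_exp (Nat.card A : ℝ)]
      _ = e ^ Nat.card A := by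
          rw [he, ← Real.exp_nat_mul, ← Real.exp_nat_mul, hb, mul_comm]
  have hpos : (0 : ℝ) < Fintype.card (Scandictor A (G m) (square m)) := by
    exact_mod_cast Fintype.card_pos
  have h1 : (Fintype.card (Scandictor A (G m) (square m)) : ℝ) ≤
      ((square m).card * (G m).card) ^ ((square m).card * Nat.card A ^ (square m).card) := by
    have h := card_scandictor_le (A := A) (D := G m) (B := square m)
    rw [Nat.card_eq_fintype_card (α := G m), Fintype.card_coe] at h
    exact_mod_cast h
  have h2 := Real.log_le_log hpos h1
  rw [Real.log_pow] at h2
  push_cast at h2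
  calc _ ≤ _ := h2
    _ ≤ ((square m).card * (Nat.card A : ℝ) ^ (square m).card) *
        ((square m).card * (G m).card) := by
        gcongr
        exact Real.log_le_self (by positivity)
    _ ≤ (e * e ^ Nat.card A) * (e * (C * e ^ p)) := by gcongr
    _ = _ := by ring

/-- For `m = o(√(log n))`, every power of `exp (m ^ 2)` is `n ^ o(1)`, so that the regret and the loss
on the remaining sites are `o(n ^ 2)`. -/
theorem tendsto_regret {lmax : ℝ} (hlmax : 0 ≤ lmax) {m : ℕ → ℕ}
    (ho : (fun n : ℕ => (m n : ℝ)) =o[atTop] (fun n : ℕ => √(Real.log n))) {Λ : ℕ → ℝ} {C q : ℕ}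
    (hΛ : ∀ m : ℕ, Λ m ≤ C * Real.exp ((m : ℝ) ^ 2) ^ q) :
    Tendsto (fun n : ℕ => (2 * (lmax * m n * (n + m n)) * √(Λ (m n)) + 2 * m n * n * lmax) /
      (n : ℝ) ^ 2) atTop (𝓝 0) := by
  set C' : ℝ := lmax * (4 * (1 + C) + 2) with hC'
  have hlim : Tendsto (fun n : ℕ => C' / √(n : ℝ)) atTop (𝓝 0) :=
    tendsto_const_nhds.div_atTop (Real.tendsto_sqrt_atTop.comp tendsto_natCast_atTop_atTop)
  have hδ : (0 : ℝ) < 1 / √(2 * (q + 1)) := by positivity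
  refine tendsto_of_tendsto_of_tendsto_of_le_of_le' tendsto_const_nhds hlim
    (Eventually.of_forall fun n => by positivity) ?_
  filter_upwards [ho.def hδ, eventually_gt_atTop 0] with n hn hn0
  have hn1 : (1 : ℝ) ≤ n := by exact_mod_cast hn0
  have hn' : (0 : ℝ) < n := by linarith
  set e := Real.exp ((m n : ℝ) ^ 2) with he
  have he1 : 1 ≤ e := Real.one_le_exp (by positivity)
  -- The choice of the constant makes `X = exp (m ^ 2) ^ (q + 1)` at most `√n`.
  have hX : e ^ (q + 1) ≤ √(n : ℝ) := by
    have hlog : 0 ≤ Real.log n := Real.log_nonneg hn1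
    rw [Real.norm_of_nonneg (by positivity), Real.norm_of_nonneg (by positivity)] at hn
    have h1 := pow_le_pow_left₀ (by positivity) hn 2
    rw [mul_pow, Real.sq_sqrt hlog, div_pow, Real.sq_sqrt (by positivity)] at h1
    rw [he, ← Real.exp_nat_mul]
    refine Real.le_sqrt_of_sq_le ?_
    rw [← Real.exp_nat_mul, ← Real.le_log_iff_exp_le hn']
    rw [one_pow, div_mul_eq_mul_div, one_mul, le_div_iff₀ (by positivity)] at h1
    push_cast
    linarith
  set X := e ^ (q + 1) with hXdef
  have hme : (m n : ℝ) ≤ e := by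
    have h1 : (m n : ℝ) ≤ (m n : ℝ) ^ 2 := by exact_mod_cast Nat.le_self_pow two_ne_zero (m n)
    linarith [Real.add_one_le_exp ((m n : ℝ) ^ 2)]
  have hmX : (m n : ℝ) ≤ X := hme.trans (le_self_pow₀ he1 q.succ_ne_zero)
  have hXn : X ≤ n := by
    refine hX.trans ((Real.sqrt_le_left hn'.le).2 ?_)
    nlinarith
  have hΛX : m n * √(Λ (m n)) ≤ (1 + C) * X := by
    have h1 : √(Λ (m n)) ≤ (1 + C) * e ^ q := by
      have heq : 1 ≤ e ^ q := one_le_pow₀ he1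
      have hC : (0 : ℝ) ≤ C := Nat.cast_nonneg C
      refine (Real.sqrt_le_left (by positivity)).2 ((hΛ (m n)).trans ?_)
      rw [← he]
      nlinarith [mul_nonneg hC (sub_nonneg.2 heq), mul_nonneg (mul_nonneg hC hC)
        (sq_nonneg (e ^ q)), mul_nonneg hC (sq_nonneg (e ^ q)), sq_nonneg (e ^ q)]
    calc m n * √(Λ (m n)) ≤ e * ((1 + C) * e ^ q) := by gcongr
      _ = (1 + C) * X := by rw [hXdef]; ring
  have hnum : 2 * (lmax * m n * (n + m n)) * √(Λ (m n)) + 2 * m n * n * lmax ≤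
      C' * n * √(n : ℝ) := by
    calc 2 * (lmax * m n * (n + m n)) * √(Λ (m n)) + 2 * m n * n * lmax
        = lmax * (2 * (n + m n) * (m n * √(Λ (m n))) + 2 * n * m n) := by ring
      _ ≤ lmax * (2 * (n + n) * ((1 + C) * √(n : ℝ)) + 2 * n * √(n : ℝ)) := by
          have h1 : (m n : ℝ) ≤ n := hmX.trans hXn
          have h2 : m n * √(Λ (m n)) ≤ (1 + C) * √(n : ℝ) := hΛX.trans (by gcongr)
          have h3 : (m n : ℝ) ≤ √(n : ℝ) := hmX.trans hX
          refine mul_le_mul_of_nonneg_left (add_le_add (mul_le_mul ?_ h2 ?_ ?_) ?_) hlmax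
          · linarith
          · positivity
          · positivity
          · exact mul_le_mul_of_nonneg_left h3 (by positivity)
      _ = C' * n * √(n : ℝ) := by rw [hC']; ring
  rw [div_le_div_iff₀ (by positivity) (by positivity)]
  calc _ ≤ C' * n * √(n : ℝ) * √(n : ℝ) := by gcongr
    _ = C' * (n : ℝ) ^ 2 := by rw [mul_assoc, Real.mul_self_sqrt hn'.le]; ring

/-- The block size `⌊log (log n)⌋` is small enough. -/
theorem exists_blockSize : ∃ m : ℕ → ℕ, Tendsto m atTop atTop ∧
    (fun n : ℕ => (m n : ℝ)) =o[atTop] (fun n : ℕ => √(Real.log n)) := by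
  have hlog : Tendsto (fun n : ℕ => Real.log n) atTop atTop :=
    Real.tendsto_log_atTop.comp tendsto_natCast_atTop_atTop
  refine ⟨fun n => ⌊Real.log (Real.log n)⌋₊,
    tendsto_nat_floor_atTop.comp (Real.tendsto_log_atTop.comp hlog), ?_⟩
  have h := isLittleO_log_rpow_atTop (r := 1 / 2) (by norm_num)
  simp only [Real.sqrt_eq_rpow]
  refine IsBigO.trans_isLittleO (IsBigO.of_bound' ?_) (h.comp_tendsto hlog)
  filter_upwards [(Real.tendsto_log_atTop.comp hlog).eventually_ge_atTop 0] with n hn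
  rw [Function.comp_apply] at hn ⊢
  rw [Real.norm_of_nonneg (by positivity), Real.norm_of_nonneg hn]
  exact Nat.floor_le hn

/-! ### Convergence to the scandictability -/

/-- The normalized expected loss lies between the scandictability of `Q` on `V_n` and that on `V_m`
plus terms that vanish, and both scandictabilities tend to `U(l, Q)`. -/
theorem exists_expWeighting_achieves {A D : Type*} [Finite A] [MeasurableSpace A]
    [MeasurableSingletonClass A] [Nonempty D] (l : A → D → ℝ) (lmax : ℝ)
    (hl0 : ∀ a d, 0 ≤ l a d) (hl : ∀ a d, l a d ≤ lmax) {G : ℕ → Finset D}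
    (hG : ∀ k, (G k).Nonempty)
    (hround : ∀ k : ℕ, 0 < k → ∀ d, ∃ d' ∈ G k, ∀ a, |l a d - l a d'| ≤ 1 / (k : ℝ) ^ 4)
    {C p : ℕ} (hcard : ∀ k, (G k).card ≤ C * (k + 1) ^ p) {m : ℕ → ℕ}
    (hm : Tendsto m atTop atTop)
    (ho : (fun n : ℕ => (m n : ℝ)) =o[atTop] (fun n : ℕ => √(Real.log n))) :
    ∃ R : (n : ℕ) → RandomizedScandictor A D (square n),
      (∀ n, IsExpWeighting l lmax (m n) (G (m n)) (R n)) ∧ AchievesScandictability l R := by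
  have hne (k : ℕ) : Nonempty (G k) := (hG k).to_subtype
  choose S hS using fun (n : ℕ) (J : Selection A (G (m n)) (m n) (n / m n * (n / m n))) =>
    exists_followsVia (Nat.mul_div_le n (m n)) (Subtype.val : G (m n) → D) J
  refine ⟨fun n => (selectionPMF (fun a (d : G (m n)) => l a d) (learningRate lmax
    (Fintype.card (Scandictor A (G (m n)) (square (m n)))) n (m n)) (m n)
      (n / m n * (n / m n))).map (S n), fun n => ⟨_, S n, rfl, hS n, fun x j => ?_⟩,
    fun Q hprob hQ => ?_⟩
  · exact selectionPMF_toOuterMeasure _ _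
      (fun i => pastBlocks (m n) (n / m n) x i) j
  have hA : Nonempty A := by
    obtain ⟨x⟩ := nonempty_of_isProbabilityMeasure Q
    exact ⟨x 0⟩
  have hlmax : 0 ≤ lmax :=
    (hl0 (Classical.arbitrary A) (Classical.arbitrary D)).trans (hl _ _)
  have hlim := hQ.tendsto_scandictability hl0 hl hlmax
  refine ⟨hlim, tendsto_of_tendsto_of_tendsto_of_le_of_le' hlim
    (h := fun n => scandictabilityOn l Q (square (m n)) + 1 / (m n : ℝ) ^ 4 +
      (2 * (lmax * m n * (n + m n)) *
        √(Real.log (Fintype.card (Scandictor A (G (m n)) (square (m n))))) +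
          2 * m n * n * lmax) / (n : ℝ) ^ 2) ?_
    (Eventually.of_forall fun n => scandictabilityOn_le_meanLoss hl0 _ (S n)) ?_⟩
  · have h1 := hlim.comp hm
    have h2 : Tendsto (fun n => 1 / (m n : ℝ) ^ 4) atTop (𝓝 0) :=
      (tendsto_const_nhds.div_atTop (tendsto_pow_atTop four_ne_zero)).comp
        (tendsto_natCast_atTop_atTop.comp hm)
    have h3 := tendsto_regret hlmax ho
      (Λ := fun k => Real.log (Fintype.card (Scandictor A (G k) (square k))))
      (fun k => log_card_scandictor_le hG hcard k)
    simpa using (h1.add h2).add h3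
  · filter_upwards [hm.eventually_gt_atTop 0] with n hn
    refine hQ.meanLoss_selectionPMF_le hn hl0 hl hlmax (Subtype.val : G (m n) → D)
      (fun d => ?_) (hS n)
    obtain ⟨d', hd', h⟩ := hround (m n) hn d
    exact ⟨⟨d', hd'⟩, h⟩

end Scandiction

theorem theorem3 {A D : Type*} [Finite A] [MeasurableSpace A] [MeasurableSingletonClass A]
    [PseudoMetricSpace D] [Nonempty D] (l : A → D → ℝ) (lmax : ℝ)
    (hl_nonneg : ∀ a d, 0 ≤ l a d) (hl_le : ∀ a d, l a d ≤ lmax)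
    (hD : Finite D ∨ (Bornology.IsBounded (Set.univ : Set D) ∧
      ∃ c : ℝ, ∀ a d d', |l a d - l a d'| ≤ c * dist d d')) :
    (∃ R : (n : ℕ) → Scandiction.RandomizedScandictor A D (Scandiction.square n),
      Scandiction.AchievesScandictability l R) ∧
    (∃ G : ℕ → Finset D,
      (Finite D → ∀ k, (G k : Set D) = Set.univ) ∧
      (∀ k : ℕ, 0 < k → ∀ d, ∃ d' ∈ G k, ∀ a, |l a d - l a d'| ≤ 1 / (k : ℝ) ^ 4) ∧
      ∀ m : ℕ → ℕ, Tendsto m atTop atTop →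
        (fun n : ℕ => (m n : ℝ)) =o[atTop] (fun n : ℕ => √(Real.log n)) →
        ∃ R : (n : ℕ) → Scandiction.RandomizedScandictor A D (Scandiction.square n),
          (∀ n, Scandiction.IsExpWeighting l lmax (m n) (G (m n)) (R n)) ∧
          Scandiction.AchievesScandictability l R) := by
  obtain ⟨G, hfin, hG, hround, C, p, hcard⟩ :=
    Scandiction.exists_rounding l lmax hl_nonneg hl_le
  refine ⟨?_, G, hfin, hround, fun m hm ho =>
    Scandiction.exists_expWeighting_achieves l lmax hl_nonneg hl_le hG hround hcard hm ho⟩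
  obtain ⟨m, hm, ho⟩ := Scandiction.exists_blockSize
  obtain ⟨R, -, hR⟩ :=
    Scandiction.exists_expWeighting_achieves l lmax hl_nonneg hl_le hG hround hcard hm ho
  exact ⟨R, hR⟩
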